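/- An integral lattice $L$ of rank $n$ is $\mathbb Z^n$ with a nondegenerate (not necessarily definite) symmetric bilinear form $(x,y)\mapsto x\cdot y\in\mathbb Z$; write $x^2=x\cdot x$, let $\delta$ be the determinant of the Gram matrix of $L$ and $\sigma(L)$ the signature of the form. The dual lattice $L'$ consists of the vectors $x\in L\otimes\mathbb R$ (which necessarily lie in $L\otimes\mathbb Q$) with $x\cdot y\in\mathbb Z$ for all $y\in L$. The linking pairing of $L$ is the symmetric $\mathbb Q/\mathbb Z$-valued pairing induced by the form on the finite group $L'/L$. A characteristic covector for $L$ is an element $\xi\in L'$ with $\xi\cdot y\equiv y^2 \pmod 2$ for all $y\in L$. For an odd prime $p$ and $k\ge 1$, let $A_{p^k}$ (resp. $B_{p^k}$) denote a pairing $\lambda$ on $\mathbb Z/p^k$ for which a generator $g$ has $\lambda(g,g)=a/p^k \bmod 1$ with $a$ an integer that is a quadratic residue prime to $p$ (resp. a quadratic nonresidue) modulo $p$. Proposition. Let $L$ be an integral lattice of odd determinant $\delta$ whose linking pairing is isomorphic to the orthogonal direct sum $$\bigoplus_{i=1}^r A_{p_i^{k_i}}\oplus\bigoplus_{j=1}^s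 B_{q_j^{l_j}},$$ where $p_i,q_j$ are odd primes, not necessarily distinct, and $k_i,l_j\ge 1$. Then every characteristic covector $\xi$ for $L$ satisfies $$\xi^2\equiv\sigma(L)-\sum_{k_i\ \mathrm{odd}}(1-p_i)-\sum_{l_j\ \mathrm{odd}}(5-q_j)\pmod{\tfrac{8}{\delta}},$$ that is, the difference of the two sides is an integer multiple of $8/\delta$. -/

import Mathlib

/-- An integral lattice of rank `n`: the free abelian group `ℤⁿ` with a nondegenerate symmetric
bilinear form with values in `ℤ` (not assumed to be definite). -/
structure IntegralLattice (n : ℕ) where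
  form : LinearMap.BilinForm ℤ (Fin n → ℤ)
  symm : form.IsSymm
  nondegenerate : form.Nondegenerate

namespace IntegralLattice

variable {n : ℕ} (L : IntegralLattice n)

/-- The Gram matrix of the standard basis of `ℤⁿ`. -/
def gram : Matrix (Fin n) (Fin n) ℤ := LinearMap.BilinForm.toMatrix' L.form

/-- The determinant of the lattice. -/
def det : ℤ := L.gram.det

/-- The extension of the form to the vector space `Kⁿ = L ⊗ K`. -/
def extend (K : Type*) [Field K] : LinearMap.BilinForm K (Fin n → K) :=
  Matrix.toBilin' (L.gram.map (Int.cast : ℤ → K))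

/-- The extended form restricts to the given one on `ℤⁿ`. -/
theorem extend_intCast (K : Type*) [Field K] (x y : Fin n → ℤ) :
    L.extend K (fun i => (x i : K)) (fun i => (y i : K)) = (L.form x y : K) := by
  have h : L.form x y = ∑ i, ∑ j, x i * L.gram i j * y j := by
    rw [← Matrix.toBilin'_apply, gram, Matrix.toBilin'_toMatrix']
  rw [h, extend, Matrix.toBilin'_apply]
  push_cast
  rfl

/-- The extended form is symmetric. -/
theorem extend_comm (K : Type*) [Field K] (x y : Fin n → K) :
    L.extend K x y = L.extend K y x := by
  have hs : ∀ i j, L.gram i j = L.gram j i := fun i j => by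
    simp only [gram, LinearMap.BilinForm.toMatrix'_apply]
    exact L.symm.eq _ _
  simp only [extend, Matrix.toBilin'_apply, Matrix.map_apply]
  rw [Finset.sum_comm]
  refine Finset.sum_congr rfl fun i _ => Finset.sum_congr rfl fun j _ => ?_
  rw [hs i j]
  ring

/-- The signature `σ(L)`: the signature of the real quadratic form `x ↦ x · x` on `L ⊗ ℝ`. -/
noncomputable def signature : ℤ :=
  (sigPos (L.extend ℝ).toQuadraticMap : ℤ) -
    (sigNeg (L.extend ℝ).toQuadraticMap : ℤ)

/-- The lattice `ℤⁿ` as a subgroup of `L ⊗ ℚ = ℚⁿ`. -/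
def integral (n : ℕ) : Submodule ℤ (Fin n → ℚ) :=
  LinearMap.range ((Algebra.linearMap ℤ ℚ).compLeft (Fin n))

/-- The dual lattice `L'`: the vectors `x` with `x · y ∈ ℤ` for all `y ∈ L`. As the form is
integral and nondegenerate, all such vectors of `L ⊗ ℝ` lie in `L ⊗ ℚ`. -/
def dual : Submodule ℤ (Fin n → ℚ) := (L.extend ℚ).dualSubmodule (integral n)

/-- A characteristic covector: `ξ ∈ L'` with `ξ · y ≡ y²` modulo `2` for all `y ∈ L`. -/
def IsCharacteristic (ξ : Fin n → ℚ) : Prop :=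
  ξ ∈ L.dual ∧ ∀ y ∈ integral n, L.extend ℚ ξ y ≡ L.extend ℚ y y [PMOD (2 : ℚ)]

/-- The finite group `L' / L`. -/
abbrev DiscriminantGroup : Type := L.dual ⧸ (integral n).submoduleOf L.dual

/-- The pairing `(x, y) ↦ x · y mod ℤ` on `L'`. -/
def dualPairing : L.dual →ₗ[ℤ] L.dual →ₗ[ℤ] AddCircle (1 : ℚ) :=
  LinearMap.mk₂ ℤ (fun x y => ((L.extend ℚ x y : ℚ) : AddCircle (1 : ℚ)))
    (fun x x' y => by simp)
    (fun c x y => by rw [Submodule.coe_smul, ← AddCircle.coe_zsmul, map_zsmul,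
      LinearMap.smul_apply])
    (fun x y y' => by simp)
    (fun c x y => by rw [Submodule.coe_smul, ← AddCircle.coe_zsmul, map_zsmul])

theorem dualPairing_eq_zero_of_right (x y : L.dual)
    (hy : y ∈ (integral n).submoduleOf L.dual) : L.dualPairing x y = 0 := by
  obtain ⟨m, hm⟩ := Submodule.mem_one.mp (x.2 (y : Fin n → ℚ) hy)
  change ((L.extend ℚ x y : ℚ) : AddCircle (1 : ℚ)) = 0
  rw [← hm, AddCircle.coe_eq_zero_iff]
  exact ⟨m, by simp⟩

theorem dualPairing_comm (x y : L.dual) : L.dualPairing x y = L.dualPairing y x := by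
  change ((L.extend ℚ x y : ℚ) : AddCircle (1 : ℚ)) = ((L.extend ℚ y x : ℚ) : AddCircle (1 : ℚ))
  rw [L.extend_comm]

/-- The linking pairing `L'/L × L'/L → ℚ/ℤ` induced by the form. -/
def linkingPairing :
    L.DiscriminantGroup →ₗ[ℤ] L.DiscriminantGroup →ₗ[ℤ] AddCircle (1 : ℚ) :=
  L.dualPairing.liftQ₂ _ _
    (fun x hx => LinearMap.mem_ker.mpr (LinearMap.ext fun y => by
      rw [L.dualPairing_comm]; exact L.dualPairing_eq_zero_of_right y x hx))
    (fun y hy => LinearMap.mem_ker.mpr (LinearMap.ext fun x =>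
      L.dualPairing_eq_zero_of_right x y hy))

theorem linkingPairing_mk (x y : L.dual) :
    L.linkingPairing (Submodule.Quotient.mk x) (Submodule.Quotient.mk y) =
      ((L.extend ℚ x y : ℚ) : AddCircle (1 : ℚ)) := rfl

end IntegralLattice

/-- A `ℚ/ℤ`-valued biadditive pairing on an abelian group. -/
abbrev TorsionPairing (G : Type*) [AddCommGroup G] : Type _ := G →ₗ[ℤ] G →ₗ[ℤ] AddCircle (1 : ℚ)

namespace TorsionPairing

/-- Two pairings are isomorphic: some isomorphism of the groups carries one to the other. -/
def Isomorphic {G H : Type*} [AddCommGroup G] [AddCommGroup H]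
    (b : TorsionPairing G) (c : TorsionPairing H) : Prop :=
  ∃ e : G ≃ₗ[ℤ] H, ∀ x y, c (e x) (e y) = b x y

/-- The orthogonal direct sum of a finite family of pairings. -/
def directSum {ι : Type*} [Fintype ι] {G : ι → Type*} [∀ i, AddCommGroup (G i)]
    (b : ∀ i, TorsionPairing (G i)) : TorsionPairing (∀ i, G i) :=
  ∑ i, (b i).compl₁₂ (LinearMap.proj i) (LinearMap.proj i)

/-- The orthogonal direct sum of two pairings. -/
def prod {G H : Type*} [AddCommGroup G] [AddCommGroup H]
    (b : TorsionPairing G) (c : TorsionPairing H) : TorsionPairing (G × H) :=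
  b.compl₁₂ (LinearMap.fst ℤ G H) (LinearMap.fst ℤ G H) +
    c.compl₁₂ (LinearMap.snd ℤ G H) (LinearMap.snd ℤ G H)

/-- The pairing on `ℤ/p^k` is of type `A_{p^k}`: some generator has square `a / p^k` in `ℚ/ℤ`,
where `a` is a quadratic residue modulo `p` (in particular prime to `p`). -/
def IsTypeA (p k : ℕ) (b : TorsionPairing (ZMod (p ^ k))) : Prop :=
  ∃ (g : ZMod (p ^ k)) (a : ℤ), AddSubgroup.zmultiples g = ⊤ ∧
    b g g = (((a : ℚ) / (p : ℚ) ^ k : ℚ) : AddCircle (1 : ℚ)) ∧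
    (a : ZMod p) ≠ 0 ∧ IsSquare (a : ZMod p)

/-- The pairing on `ℤ/p^k` is of type `B_{p^k}`: some generator has square `a / p^k` in `ℚ/ℤ`,
where `a` is a quadratic nonresidue modulo `p`. -/
def IsTypeB (p k : ℕ) (b : TorsionPairing (ZMod (p ^ k))) : Prop :=
  ∃ (g : ZMod (p ^ k)) (a : ℤ), AddSubgroup.zmultiples g = ⊤ ∧
    b g g = (((a : ℚ) / (p : ℚ) ^ k : ℚ) : AddCircle (1 : ℚ)) ∧
    ¬ IsSquare (a : ZMod p)

end TorsionPairing

/-! Put M = L ⊕ ⟨1⟩. Modulo 2 its form is nondegenerate and not alternating, so it has an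
orthonormal basis over 𝔽₂; a denominator-free Gram–Schmidt process lifts this to orthogonal vectors
e_i of M, spanning a sublattice of finite index, whose norms a_i are odd (`exists_orthogonal_odd`).
The summand ⟨1⟩ is there because L itself may be even.

The covector (ξ, 1) is characteristic for M, so its products c_i with the e_i are odd and c_i² ≡
a_i² ≡ 1 mod 8. Hence ξ² + 1 = ∑ c_i²/a_i agrees with ∑ a_i up to 8 times a fraction of odd
denominator (`IsCharacteristic.exists_norm_eq`). As δξ² is an integer (`exists_det_mul_norm_eq`), it
remains to find ∑ a_i modulo 8.

This is done with Gauss sums. Passing from M to the sublattice spanned by the e_i multiplies the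
Gauss sum of the linking pairing by a natural number h (`exists_gaussSum_directSum_eq`). With ζ =
`eighthRoot`, each ⟨a_i⟩ contributes the phase ζ^(a_i - sign a_i), and the signs add up to σ(L) + 1
(`signature_add_one`); each A or B with odd exponent contributes ζ^(p - 1) or ζ^(q - 5), and the
others contribute none. Both kinds of phase come from `gaussSum_cyclic`, which rests on quadratic
reciprocity.

The sign of the quadratic Gauss sum is never needed. The unknown square roots are collected in the
multiplicative function `gaussRoot`, with `gaussRoot n ^ 2 = n` for odd n. Absolute values show that
the two orders differ by the factor h², and `gaussRoot (h ^ 2) = h`, so the roots cancel and only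
the phases remain (`eight_dvd_of_gaussRoot_mul_eq`). -/

/-! ### The standard character of ℚ/ℤ. -/

/-- The character `x ↦ exp (2πix)` of `ℚ/ℤ`, as a homomorphism to the unit circle. -/
noncomputable def ratCircleHom : AddCircle (1 : ℚ) →+ Additive Circle :=
  QuotientAddGroup.lift _
    (Circle.expHom.comp ((AddMonoidHom.mulLeft (2 * Real.pi)).comp
      (Rat.castHom ℝ).toAddMonoidHom)) (by
    rintro _ ⟨m, rfl⟩
    refine Additive.toMul.injective (Circle.ext ?_)
    simp [Circle.coe_exp, Complex.exp_eq_one_iff]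
    exact ⟨m, by ring⟩)

/-- The character `x ↦ exp (2πix)` of `ℚ/ℤ`. -/
noncomputable def ratChar : AddChar (AddCircle (1 : ℚ)) ℂ where
  toFun x := ((ratCircleHom x).toMul : ℂ)
  map_zero_eq_one' := by simp
  map_add_eq_mul' x y := by simp

theorem norm_ratChar (x : AddCircle (1 : ℚ)) : ‖ratChar x‖ = 1 :=
  Circle.norm_coe _

theorem ratChar_coe (q : ℚ) :
    ratChar (q : AddCircle (1 : ℚ)) = Complex.exp (2 * Real.pi * q * Complex.I) := by
  change ((Circle.exp (2 * Real.pi * (q : ℝ)) : Circle) : ℂ) = _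
  rw [Circle.coe_exp]
  push_cast
  rfl

theorem ratChar_eq_one_iff (x : AddCircle (1 : ℚ)) : ratChar x = 1 ↔ x = 0 := by
  refine ⟨fun h => ?_, fun h => by rw [h, AddChar.map_zero_eq_one]⟩
  induction x using QuotientAddGroup.induction_on with
  | H q =>
    change ratChar (q : AddCircle (1 : ℚ)) = 1 at h
    change (q : AddCircle (1 : ℚ)) = 0
    rw [ratChar_coe, Complex.exp_eq_one_iff] at h
    obtain ⟨m, hm⟩ := h
    rw [AddCircle.coe_eq_zero_iff]
    refine ⟨m, ?_⟩
    have h2 : (2 * Real.pi * Complex.I : ℂ) ≠ 0 := Complex.two_pi_I_ne_zero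
    have : ((m : ℂ)) = (q : ℂ) := by
      apply mul_right_cancel₀ h2
      rw [← hm]; ring
    simp
    exact_mod_cast this

/-! ### Gauss sums of pairings and their reduction along isotropic subgroups. -/

namespace TorsionPairing

open Finset

variable {G H X : Type*} [AddCommGroup G] [AddCommGroup H] [AddCommGroup X]

/-- The normalized quadratic Gauss sum `∑ exp (-4πi b(x, x))` of a pairing. -/
noncomputable def gaussSum [Fintype G] (b : TorsionPairing G) : ℂ :=
  ∑ x, ratChar ((-2 : ℤ) • b x x)

/-- Values of the pairing are killed by the odd order of G, on which 4 is invertible. The 4 is the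
factor 2 of the normalization times the 2 of the cross term in b(d + x, d + x). -/
theorem eq_zero_of_odd_card [Fintype G] (hG : Odd (Fintype.card G)) (b : TorsionPairing G)
    {x y : G} (h : (-4 : ℤ) • b x y = 0) : b x y = 0 := by
  have h1 : (Fintype.card G : ℤ) • b x y = 0 := by
    rw [← LinearMap.map_smul, natCast_zsmul, card_nsmul_eq_zero, map_zero]
  have hc : IsCoprime (Fintype.card G : ℤ) (-4) := by
    have : Nat.Coprime (Fintype.card G) (2 ^ 2) := (hG.coprime_two_right).pow_right 2
    have := (Nat.isCoprime_iff_coprime.mpr this).neg_right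
    exact_mod_cast this
  obtain ⟨u, v, huv⟩ := hc
  rw [← one_smul ℤ (b x y), ← huv, add_smul, mul_smul, mul_smul, h, h1]
  simp

/-- Only the orthogonal complement of a totally isotropic subgroup contributes to the
Gauss sum. -/
theorem gaussSum_eq_sum_orthogonal [Fintype G] (hG : Odd (Fintype.card G))
    (b : TorsionPairing G) (hb : ∀ x y, b x y = b y x) (N : AddSubgroup G)
    (hN : ∀ x ∈ N, b x x = 0) (K : Set G) [DecidablePred (· ∈ K)]
    (hK : ∀ d, d ∈ K ↔ ∀ x ∈ N, b d x = 0) :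
    b.gaussSum = ∑ d with d ∈ K, ratChar ((-2 : ℤ) • b d d) := by
  classical
  -- Translating the summation variable by x ∈ N multiplies the d-th term by ψ d x. Averaging over N
  -- therefore keeps exactly the d for which ψ d is trivial.
  let ψ : G → AddChar N ℂ := fun d =>
    ratChar.compAddMonoidHom (((-4 : ℤ) • (b d).toAddMonoidHom).comp N.subtype)
  have hψ : ∀ d (x : N), ψ d x = ratChar ((-4 : ℤ) • b d x) := fun d x => rfl
  have hψ0 : ∀ d, ψ d = 0 ↔ d ∈ K := by
    intro d
    rw [hK]
    constructor
    · intro h x hx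
      have := hψ d ⟨x, hx⟩
      rw [h, AddChar.zero_apply, eq_comm, ratChar_eq_one_iff] at this
      exact eq_zero_of_odd_card hG b this
    · intro h
      ext x
      rw [hψ, h x x.2]
      simp
  have hcard : (Fintype.card N : ℂ) ≠ 0 := by
    exact_mod_cast Fintype.card_ne_zero
  apply mul_left_cancel₀ hcard
  have hshift : ∀ x : N, b.gaussSum = ∑ d, ratChar ((-2 : ℤ) • b d d) * ψ d x := by
    intro x
    rw [gaussSum, ← Equiv.sum_comp (Equiv.addRight (x : G))]
    refine Finset.sum_congr rfl fun d _ => ?_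
    rw [hψ, ← AddChar.map_add_eq_mul]
    congr 1
    simp only [Equiv.coe_addRight, map_add, LinearMap.add_apply, hN x x.2, hb x d]
    module
  calc (Fintype.card N : ℂ) * b.gaussSum = ∑ _x : N, b.gaussSum := by simp
    _ = ∑ x : N, ∑ d, ratChar ((-2 : ℤ) • b d d) * ψ d x :=
        Finset.sum_congr rfl fun x _ => hshift x
    _ = ∑ d, ratChar ((-2 : ℤ) • b d d) * ∑ x : N, ψ d x := by
        rw [Finset.sum_comm]
        simp_rw [Finset.mul_sum]
    _ = _ := by
        rw [Finset.mul_sum, Finset.sum_filter]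
        refine Finset.sum_congr rfl fun d _ => ?_
        rw [AddChar.sum_eq_ite]
        simp only [hψ0]
        split_ifs <;> ring

/-- Reduction of a Gauss sum along a totally isotropic subgroup `N = θ (ker π)`, whose
orthogonal complement `θ X` maps onto `H` with kernel `N`. -/
theorem gaussSum_eq_card_mul [Fintype G] [Fintype H] (hG : Odd (Fintype.card G))
    (b : TorsionPairing G) (c : TorsionPairing H) (hb : ∀ x y, b x y = b y x)
    (θ : X →+ G) (π : X →+ H) (hπ : Function.Surjective π) (hker : ∀ x, θ x = 0 → π x = 0)
    (hbc : ∀ x y, b (θ x) (θ y) = c (π x) (π y))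
    (hK : ∀ d, (∀ x, π x = 0 → b d (θ x) = 0) → ∃ x, θ x = d) :
    b.gaussSum = Nat.card (π.ker.map θ) * c.gaussSum := by
  classical
  have hmem : ∀ g ∈ π.ker.map θ, ∃ x, π x = 0 ∧ θ x = g := by
    rintro _ ⟨x, hx, rfl⟩
    exact ⟨x, hx, rfl⟩
  rw [gaussSum_eq_sum_orthogonal hG b hb (π.ker.map θ) ?_ (Set.range θ)]
  -- The section s splits the orthogonal complement θ X into cosets of N indexed by H, and the
  -- summand is constant on each coset.
  · obtain ⟨s, hs⟩ := hπ.hasRightInverse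
    have hval : ∀ (y : H) (g : π.ker.map θ),
        ratChar ((-2 : ℤ) • b (θ (s y) + g) (θ (s y) + g)) = ratChar ((-2 : ℤ) • c y y) := by
      rintro y ⟨g, hg⟩
      obtain ⟨x, hx, rfl⟩ := hmem g hg
      simp only [← map_add, hbc]
      simp only [map_add, hx, hs y, add_zero]
    rw [gaussSum, Nat.card_eq_fintype_card, Finset.mul_sum]
    have : ∀ y : H, (Fintype.card (π.ker.map θ) : ℂ) * ratChar ((-2 : ℤ) • c y y) =
        ∑ g : π.ker.map θ, ratChar ((-2 : ℤ) • b (θ (s y) + g) (θ (s y) + g)) := by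
      intro y
      simp only [hval, Finset.sum_const, Finset.card_univ, nsmul_eq_mul]
    simp_rw [this]
    rw [← Fintype.sum_prod_type']
    symm
    refine Finset.sum_bij (fun z _ => θ (s z.1) + z.2) ?_ ?_ ?_ (fun _ _ => rfl)
    · rintro ⟨y, g, hg⟩ -
      obtain ⟨x, hx, rfl⟩ := hmem g hg
      simp [← map_add]
    · rintro ⟨y, g, hg⟩ - ⟨y', g', hg'⟩ - h
      obtain ⟨x, hx, rfl⟩ := hmem g hg
      obtain ⟨x', hx', rfl⟩ := hmem g' hg'
      have h0 : θ ((s y + x) - (s y' + x')) = 0 := by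
        rw [map_sub, map_add, map_add, sub_eq_zero]; exact h
      have h1 := hker _ h0
      simp only [map_sub, map_add, hx, hx', hs y, hs y', add_zero, sub_eq_zero] at h1
      subst h1
      simpa using h
    · intro d hd
      obtain ⟨x, rfl⟩ := (Finset.mem_filter.mp hd).2
      exact ⟨⟨π x, θ (x - s (π x)), x - s (π x), by simp [hs (π x)], rfl⟩, Finset.mem_univ _,
        by simp⟩
  · intro d
    constructor
    · rintro ⟨y, rfl⟩ g hg
      obtain ⟨x, hx, rfl⟩ := hmem g hg
      rw [hbc, hx, map_zero]
    · exact fun h => hK d fun x hx => h _ ⟨x, hx, rfl⟩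
  · intro g hg
    obtain ⟨x, hx, rfl⟩ := hmem g hg
    rw [hbc, hx, map_zero]

theorem gaussSum_congr [Fintype G] [Fintype H] {b : TorsionPairing G} {c : TorsionPairing H}
    (e : G ≃ H) (h : ∀ x, c (e x) (e x) = b x x) : b.gaussSum = c.gaussSum := by
  simp only [gaussSum, ← h]
  exact Equiv.sum_comp e fun y => ratChar ((-2 : ℤ) • c y y)

theorem prod_apply (b : TorsionPairing G) (c : TorsionPairing H) (x y : G × H) :
    prod b c x y = b x.1 y.1 + c x.2 y.2 := rfl

theorem directSum_apply {ι : Type*} [Fintype ι] {G : ι → Type*} [∀ i, AddCommGroup (G i)]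
    (b : ∀ i, TorsionPairing (G i)) (x y : ∀ i, G i) :
    directSum b x y = ∑ i, b i (x i) (y i) := by
  simp [directSum, LinearMap.sum_apply]

theorem gaussSum_prod [Fintype G] [Fintype H] (b : TorsionPairing G) (c : TorsionPairing H) :
    (prod b c).gaussSum = b.gaussSum * c.gaussSum := by
  simp only [gaussSum, prod_apply, smul_add, AddChar.map_add_eq_mul, Fintype.sum_prod_type,
    Finset.sum_mul_sum]

theorem gaussSum_directSum {ι : Type*} [Fintype ι] [DecidableEq ι] {G : ι → Type*}
    [∀ i, AddCommGroup (G i)] [∀ i, Fintype (G i)] (b : ∀ i, TorsionPairing (G i)) :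
    (directSum b).gaussSum = ∏ i, (b i).gaussSum := by
  simp only [gaussSum, directSum_apply, Finset.smul_sum, Finset.prod_univ_sum,
    Fintype.piFinset_univ]
  refine Finset.sum_congr rfl fun x _ => ?_
  induction (Finset.univ : Finset ι) using Finset.induction_on with
  | empty => simp
  | insert i s hi ih => rw [Finset.sum_insert hi, Finset.prod_insert hi, AddChar.map_add_eq_mul, ih]

end TorsionPairing

/-! ### Gauss sums over finite fields and of cyclic pairings. -/

open Finset in
/-- A quadratic exponential sum over a finite field of odd characteristic is a Gauss sum. -/
theorem sum_addChar_mul_sq {F : Type*} [Field F] [Fintype F] [DecidableEq F]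
    (hF : ringChar F ≠ 2) {ψ : AddChar F ℂ} (hψ : ψ.IsPrimitive) {c : F} (hc : c ≠ 0) :
    ∑ x, ψ (c * x ^ 2) = quadraticChar F c *
      gaussSum ((quadraticChar F).ringHomComp (Int.castRingHom ℂ)) ψ := by
  -- An element y has 1 + χ(y) square roots, χ being the quadratic character.
  have hfib : ∑ x, ψ (c * x ^ 2) = ∑ y, ((quadraticChar F y : ℂ) + 1) * ψ (c * y) := by
    rw [← Finset.sum_fiberwise_of_maps_to (t := Finset.univ) (g := fun x : F => x ^ 2)
      (fun _ _ => Finset.mem_univ _)]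
    refine Finset.sum_congr rfl fun y _ => ?_
    rw [Finset.sum_congr rfl (g := fun _ => ψ (c * y)) fun x hx => by
      rw [(Finset.mem_filter.mp hx).2], Finset.sum_const, nsmul_eq_mul]
    have := quadraticChar_card_sqrts hF y
    rw [Set.toFinset_ofPred] at this
    congr 1
    exact_mod_cast this
  have hsum : ∑ y, ψ (c * y) = 0 := by
    have := AddChar.sum_eq_zero_of_ne_one (hψ hc)
    simpa [AddChar.mulShift_apply] using this
  have hsq : ((quadraticChar F c : ℂ)) * (quadraticChar F c : ℂ) = 1 := by
    have := quadraticChar_sq_one hc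
    rw [sq] at this
    exact_mod_cast this
  rw [hfib, ← gaussSum_mulShift _ ψ (Units.mk0 c hc)]
  simp only [add_mul, Finset.sum_add_distrib, one_mul, hsum, add_zero, gaussSum,
    MulChar.ringHomComp_apply, Units.val_mk0, AddChar.mulShift_apply, eq_intCast]
  rw [← mul_assoc, hsq, one_mul]

theorem ratCircle_coe_eq_iff (x y : ℚ) :
    (x : AddCircle (1 : ℚ)) = y ↔ ∃ m : ℤ, x = y + m := by
  rw [← sub_eq_zero, ← AddCircle.coe_sub, AddCircle.coe_eq_zero_iff]
  refine exists_congr fun m => ?_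
  rw [zsmul_eq_mul, mul_one, eq_sub_iff_add_eq, eq_comm, add_comm]

/-- The embedding of `ℤ/N` into `ℚ/ℤ` with image `(1/N)ℤ/ℤ`. -/
noncomputable def ZMod.toRatCircle (N : ℕ) : ZMod N →+ AddCircle (1 : ℚ) :=
  ZMod.lift N ⟨zmultiplesHom _ (((N : ℚ)⁻¹ : ℚ) : AddCircle (1 : ℚ)), by
    rw [zmultiplesHom_apply, ← AddCircle.coe_zsmul, AddCircle.coe_eq_zero_iff]
    rcases eq_or_ne (N : ℚ) 0 with h | h
    · exact ⟨0, by simp [h]⟩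
    · exact ⟨1, by simp [h]⟩⟩

theorem ZMod.toRatCircle_intCast (N : ℕ) (m : ℤ) :
    ZMod.toRatCircle N m = ((m / N : ℚ) : AddCircle (1 : ℚ)) := by
  rw [ZMod.toRatCircle, ZMod.lift_coe]
  simp only [zmultiplesHom_apply]
  rw [← AddCircle.coe_zsmul, zsmul_eq_mul, div_eq_mul_inv]

theorem ZMod.toRatCircle_eq_zero_iff (N : ℕ) [NeZero N] (x : ZMod N) :
    ZMod.toRatCircle N x = 0 ↔ x = 0 := by
  refine ⟨fun h => ?_, fun h => by rw [h, map_zero]⟩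
  obtain ⟨m, rfl⟩ := ZMod.intCast_surjective x
  rw [ZMod.toRatCircle_intCast, AddCircle.coe_eq_zero_iff] at h
  obtain ⟨k, hk⟩ := h
  have hN : (N : ℚ) ≠ 0 := NeZero.ne _
  rw [ZMod.intCast_zmod_eq_zero_iff_dvd]
  refine ⟨k, ?_⟩
  simp only [zsmul_eq_mul, mul_one] at hk
  field_simp at hk
  have : (m : ℚ) = N * k := by rw [← hk, mul_comm]
  exact_mod_cast this

namespace TorsionPairing

/-- The pairing `(x, y) ↦ axy / N` on `ℤ/N`. -/
noncomputable def cyclic (N : ℕ) (a : ℤ) : TorsionPairing (ZMod N) :=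
  LinearMap.mk₂ ℤ (fun x y => ZMod.toRatCircle N (a * x * y))
    (fun x x' y => by rw [← map_add]; ring_nf)
    (fun c x y => by rw [← map_zsmul]; simp only [zsmul_eq_mul]; ring_nf)
    (fun x y y' => by rw [← map_add]; ring_nf)
    (fun c x y => by rw [← map_zsmul]; simp only [zsmul_eq_mul]; ring_nf)

theorem cyclic_apply (N : ℕ) (a : ℤ) (x y : ZMod N) :
    cyclic N a x y = ZMod.toRatCircle N (a * x * y) := rfl

theorem cyclic_intCast (N : ℕ) (a x y : ℤ) :
    cyclic N a x y = ((a * x * y / N : ℚ) : AddCircle (1 : ℚ)) := by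
  rw [cyclic_apply]
  have := ZMod.toRatCircle_intCast N (a * x * y)
  push_cast at this
  exact this

theorem cyclic_comm (N : ℕ) (a : ℤ) (x y : ZMod N) : cyclic N a x y = cyclic N a y x := by
  rw [cyclic_apply, cyclic_apply, mul_right_comm]

/-- The factor a enters the sum only through its Legendre symbol. The symbol of -2, which comes from
the normalization, is absorbed into g; only g² is determined, and that suffices. -/
theorem exists_gaussSum_cyclic_prime (p : ℕ) [hp : Fact p.Prime] (hodd : Odd p) :
    ∃ g : ℂ, g ^ 2 = (ZMod.χ₄ p : ℂ) * p ∧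
      ∀ a : ℤ, (a : ZMod p) ≠ 0 → (cyclic p a).gaussSum = jacobiSym a p * g := by
  have hp2 : p ≠ 2 := fun h => by subst h; exact absurd hodd (by decide)
  have hchar : ringChar (ZMod p) ≠ 2 := by rwa [ZMod.ringChar_zmod_n]
  have h2 : ((-2 : ℤ) : ZMod p) ≠ 0 := by
    rw [Ne, ZMod.intCast_zmod_eq_zero_iff_dvd, Int.dvd_neg]
    intro h
    have : p ∣ 2 := by exact_mod_cast h
    exact hp2 ((Nat.prime_dvd_prime_iff_eq hp.1 Nat.prime_two).mp this)
  let ψ : AddChar (ZMod p) ℂ := ratChar.compAddMonoidHom (ZMod.toRatCircle p)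
  have hψ : ψ.IsPrimitive := AddChar.zmod_char_primitive_of_eq_one_only_at_zero p ψ fun a ha =>
    (ZMod.toRatCircle_eq_zero_iff p a).mp ((ratChar_eq_one_iff _).mp ha)
  let χ := (quadraticChar (ZMod p)).ringHomComp (Int.castRingHom ℂ)
  have hχ : χ ≠ 1 := by
    intro h
    refine quadraticChar_ne_one hchar ?_
    ext u
    have := DFunLike.congr_fun h (u : ZMod p)
    simp only [χ, MulChar.ringHomComp_apply, eq_intCast, MulChar.one_apply_coe] at this ⊢
    exact_mod_cast this
  have hχq : χ.IsQuadratic := (quadraticChar_isQuadratic (ZMod p)).comp _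
  refine ⟨(quadraticChar (ZMod p) ((-2 : ℤ) : ZMod p) : ℂ) * _root_.gaussSum χ ψ, ?_, ?_⟩
  · have h1 : (quadraticChar (ZMod p) ((-2 : ℤ) : ZMod p) : ℂ) ^ 2 = 1 := by
      exact_mod_cast quadraticChar_sq_one h2
    rw [mul_pow, h1, one_mul, gaussSum_sq hχ hχq hψ, ZMod.card]
    congr 1
    simp only [χ, MulChar.ringHomComp_apply, eq_intCast]
    rw [quadraticChar_neg_one hchar, ZMod.card]
  · intro a ha
    have : ∀ x : ZMod p, ratChar ((-2 : ℤ) • cyclic p a x x) =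
        ψ (((-2 : ℤ) : ZMod p) * a * x ^ 2) := by
      intro x
      change _ = ratChar (ZMod.toRatCircle p _)
      rw [cyclic_apply, ← map_zsmul, zsmul_eq_mul]
      ring_nf
    rw [gaussSum, Finset.sum_congr rfl fun x _ => this x,
      sum_addChar_mul_sq hchar hψ (mul_ne_zero h2 ha), map_mul, ← jacobiSym.legendreSym.to_jacobiSym,
      legendreSym]
    push_cast
    ring

/-- Multiplication by `p` maps `ℤ/p^(k+1)` onto the orthogonal complement of the subgroup of
order `p` in `ℤ/p^(k+2)`. -/
theorem gaussSum_cyclic_pow_add_two (p : ℕ) [hp : Fact p.Prime] (hodd : Odd p) (k : ℕ) (a : ℤ)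
    (ha : IsCoprime a p) :
    (cyclic (p ^ (k + 2)) a).gaussSum = p * (cyclic (p ^ k) a).gaussSum := by
  have hp0 : (p : ℚ) ≠ 0 := by exact_mod_cast hp.1.ne_zero
  let θ : ℤ →+ ZMod (p ^ (k + 2)) := (Int.castAddHom _).comp (AddMonoidHom.mulLeft (p : ℤ))
  have hθ : ∀ x : ℤ, θ x = ((p * x : ℤ) : ZMod (p ^ (k + 2))) := fun x => rfl
  let π : ℤ →+ ZMod (p ^ k) := Int.castAddHom _
  have hπ : ∀ x : ℤ, π x = (x : ZMod (p ^ k)) := fun x => rfl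
  have hker : ∀ x : ℤ, π x = 0 ↔ ((p ^ k : ℕ) : ℤ) ∣ x := fun x => by
    rw [hπ, ZMod.intCast_zmod_eq_zero_iff_dvd]
  rw [gaussSum_eq_card_mul (X := ℤ) ?_ (cyclic (p ^ (k + 2)) a) (cyclic (p ^ k) a)
    (cyclic_comm _ _) θ π ZMod.intCast_surjective ?_ ?_ ?_]
  · congr 2
    have : π.ker.map θ = AddSubgroup.zmultiples ((p ^ (k + 1) : ℕ) : ZMod (p ^ (k + 2))) := by
      ext g
      rw [AddSubgroup.mem_map, AddSubgroup.mem_zmultiples_iff]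
      constructor
      · rintro ⟨x, hx, rfl⟩
        obtain ⟨y, rfl⟩ := (hker x).mp hx
        refine ⟨y, ?_⟩
        rw [hθ]
        simp only [zsmul_eq_mul]
        push_cast
        ring
      · rintro ⟨y, rfl⟩
        refine ⟨(p ^ k : ℕ) * y, (hker _).mpr (dvd_mul_right _ _), ?_⟩
        rw [hθ]
        simp only [zsmul_eq_mul]
        push_cast
        ring
    rw [this, Nat.card_zmultiples, ZMod.addOrderOf_coe _ (pow_ne_zero _ hp.1.ne_zero),
      Nat.gcd_eq_right (pow_dvd_pow _ (by omega)), Nat.pow_div (by omega) hp.1.pos]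
    simp
  · rw [ZMod.card]; exact hodd.pow
  · intro x hx
    rw [hθ, ZMod.intCast_zmod_eq_zero_iff_dvd] at hx
    rw [hker]
    obtain ⟨y, hy⟩ := hx
    refine ⟨p * y, ?_⟩
    have hp' : (p : ℤ) ≠ 0 := by exact_mod_cast hp.1.ne_zero
    apply mul_left_cancel₀ hp'
    rw [hy]
    push_cast
    ring
  · intro x y
    rw [hθ, hθ, hπ, hπ, cyclic_intCast, cyclic_intCast]
    congr 1
    push_cast
    field_simp
    ring
  · intro d hd
    obtain ⟨m, rfl⟩ := ZMod.intCast_surjective d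
    -- The image of p^k under θ is p^(k+1), a generator of the subgroup of order p; orthogonality to
    -- it alone forces p ∣ m.
    have := hd (p ^ k : ℕ) ((hker _).mpr dvd_rfl)
    rw [hθ, cyclic_intCast, AddCircle.coe_eq_zero_iff] at this
    obtain ⟨j, hj⟩ := this
    have hdvd : (p : ℤ) ∣ a * m := by
      refine ⟨j, ?_⟩
      simp only [zsmul_eq_mul, mul_one] at hj
      push_cast at hj
      field_simp at hj
      have : (a * m : ℚ) = p * j := by
        apply mul_left_cancel₀ (pow_ne_zero (k + 1) hp0)
        linear_combination (exp := 1) -hj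
      exact_mod_cast this
    obtain ⟨y, rfl⟩ := ha.symm.dvd_of_dvd_mul_left hdvd
    exact ⟨y, hθ y⟩

/-- The map (x, y) ↦ Nx + My is an isometry by the Chinese remainder theorem: a(Nx + My)²/(MN) =
aNx²/M + aMy²/N + 2axy. It is obtained as a reduction along the trivial subgroup. -/
theorem gaussSum_cyclic_mul (M N : ℕ) [NeZero M] [NeZero N] (hM : Odd M) (hN : Odd N)
    (hMN : M.Coprime N) (a : ℤ) :
    (cyclic M (a * N)).gaussSum * (cyclic N (a * M)).gaussSum = (cyclic (M * N) a).gaussSum := by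
  have hM0 : (M : ℚ) ≠ 0 := NeZero.ne _
  have hN0 : (N : ℚ) ≠ 0 := NeZero.ne _
  have hc : IsCoprime (M : ℤ) N := Nat.isCoprime_iff_coprime.mpr hMN
  let θ : ℤ × ℤ →+ ZMod M × ZMod N := (Int.castAddHom _).prodMap (Int.castAddHom _)
  have hθ : ∀ x : ℤ × ℤ, θ x = ((x.1 : ZMod M), (x.2 : ZMod N)) := fun x => rfl
  let π : ℤ × ℤ →+ ZMod (M * N) := (Int.castAddHom _).comp
    (((AddMonoidHom.mulLeft (N : ℤ)).comp (AddMonoidHom.fst ℤ ℤ)) +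
      ((AddMonoidHom.mulLeft (M : ℤ)).comp (AddMonoidHom.snd ℤ ℤ)))
  have hπ : ∀ x : ℤ × ℤ, π x = ((N * x.1 + M * x.2 : ℤ) : ZMod (M * N)) := fun x => rfl
  have hθ0 : ∀ x, θ x = 0 ↔ (M : ℤ) ∣ x.1 ∧ (N : ℤ) ∣ x.2 := fun x => by
    rw [hθ, Prod.mk_eq_zero, ZMod.intCast_zmod_eq_zero_iff_dvd, ZMod.intCast_zmod_eq_zero_iff_dvd]
  have hπ0 : ∀ x, π x = 0 ↔ ((M * N : ℕ) : ℤ) ∣ N * x.1 + M * x.2 := fun x => by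
    rw [hπ, ZMod.intCast_zmod_eq_zero_iff_dvd]
  have hsurj : Function.Surjective π := by
    intro d
    obtain ⟨m, rfl⟩ := ZMod.intCast_surjective d
    obtain ⟨u, v, huv⟩ := hc
    refine ⟨(v * m, u * m), ?_⟩
    rw [hπ]
    congr 1
    linear_combination m * huv
  rw [← gaussSum_prod, gaussSum_eq_card_mul (X := ℤ × ℤ) ?_ _ (cyclic (M * N) a) ?_ θ π hsurj
    ?_ ?_ ?_]
  · have : π.ker.map θ = ⊥ := by
      rw [AddSubgroup.map_eq_bot_iff]
      intro x hx
      have h := (hπ0 x).mp hx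
      push_cast at h
      refine (hθ0 x).mpr ⟨?_, ?_⟩
      · have h1 := (dvd_mul_right (M : ℤ) N).trans h
        rw [Int.dvd_add_left (dvd_mul_right _ _)] at h1
        exact hc.dvd_of_dvd_mul_left h1
      · have h1 := (dvd_mul_left (N : ℤ) M).trans h
        rw [Int.dvd_add_right (dvd_mul_right _ _)] at h1
        exact hc.symm.dvd_of_dvd_mul_left h1
    rw [this, AddSubgroup.card_bot, Nat.cast_one, one_mul]
  · rw [Fintype.card_prod, ZMod.card, ZMod.card]
    exact hM.mul hN
  · intro x y
    rw [prod_apply, prod_apply, cyclic_comm M, cyclic_comm N]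
  · intro x hx
    obtain ⟨⟨u, hu⟩, ⟨v, hv⟩⟩ := (hθ0 x).mp hx
    refine (hπ0 x).mpr ⟨u + v, ?_⟩
    rw [hu, hv]
    push_cast
    ring
  · intro x y
    rw [hθ, hθ, hπ, hπ, prod_apply, cyclic_intCast, cyclic_intCast, cyclic_intCast,
      ← AddCircle.coe_add, ratCircle_coe_eq_iff]
    refine ⟨-(a * (x.1 * y.2 + x.2 * y.1)), ?_⟩
    push_cast
    field_simp
    ring
  · rintro ⟨d, d'⟩ -
    obtain ⟨m, rfl⟩ := ZMod.intCast_surjective d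
    obtain ⟨m', rfl⟩ := ZMod.intCast_surjective d'
    exact ⟨(m, m'), rfl⟩

end TorsionPairing

/-! ### Explicit Gauss sums: square roots times eighth roots of unity. -/

/-- The primitive eighth root of unity `exp (2πi/8)`. -/
noncomputable def eighthRoot : ℂ := ratChar ((1 / 8 : ℚ) : AddCircle (1 : ℚ))

theorem eighthRoot_ne_zero : eighthRoot ≠ 0 := by
  rw [← norm_ne_zero_iff, eighthRoot, norm_ratChar]
  exact one_ne_zero

theorem eighthRoot_zpow (m : ℤ) : eighthRoot ^ m = ratChar ((m / 8 : ℚ) : AddCircle (1 : ℚ)) := by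
  rw [eighthRoot, ← AddChar.map_zsmul_eq_zpow, ← AddCircle.coe_zsmul]
  congr 2
  simp [div_eq_mul_inv]

theorem eighthRoot_zpow_sum {ι : Type*} (s : Finset ι) (f : ι → ℤ) :
    eighthRoot ^ (∑ i ∈ s, f i) = ∏ i ∈ s, eighthRoot ^ f i := by
  classical
  induction s using Finset.induction_on with
  | empty => simp
  | insert i s hi ih =>
    rw [Finset.sum_insert hi, Finset.prod_insert hi, zpow_add₀ eighthRoot_ne_zero, ih]

theorem norm_eighthRoot_zpow (m : ℤ) : ‖eighthRoot ^ m‖ = 1 := by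
  rw [eighthRoot_zpow, norm_ratChar]

theorem eighthRoot_zpow_eq_one_iff (m : ℤ) : eighthRoot ^ m = 1 ↔ 8 ∣ m := by
  rw [eighthRoot_zpow, ratChar_eq_one_iff, AddCircle.coe_eq_zero_iff]
  refine exists_congr fun k => ?_
  rw [zsmul_eq_mul, mul_one, eq_div_iff (by norm_num), mul_comm, eq_comm]
  norm_cast

theorem eighthRoot_zpow_congr {m n : ℤ} (h : 8 ∣ m - n) : eighthRoot ^ m = eighthRoot ^ n := by
  rw [← sub_add_cancel m n, zpow_add₀ eighthRoot_ne_zero, (eighthRoot_zpow_eq_one_iff _).mpr h,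
    one_mul]

theorem eighthRoot_zpow_four : eighthRoot ^ (4 : ℤ) = -1 := by
  have h1 : eighthRoot ^ (4 : ℤ) * eighthRoot ^ (4 : ℤ) = 1 := by
    rw [← zpow_add₀ eighthRoot_ne_zero, eighthRoot_zpow_eq_one_iff]
    norm_num
  have h2 : eighthRoot ^ (4 : ℤ) ≠ 1 := by
    rw [Ne, eighthRoot_zpow_eq_one_iff]
    norm_num
  exact (mul_self_eq_one_iff.mp h1).resolve_left h2

theorem neg_one_pow_eq_eighthRoot (n : ℕ) : (-1 : ℂ) ^ n = eighthRoot ^ (4 * n : ℤ) := by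
  rw [zpow_mul, eighthRoot_zpow_four, zpow_natCast]

theorem isCoprime_of_intCast_ne_zero {p : ℕ} [hp : Fact p.Prime] {a : ℤ} (ha : (a : ZMod p) ≠ 0) :
    IsCoprime a p := by
  rw [Ne, ZMod.intCast_zmod_eq_zero_iff_dvd] at ha
  exact ((Nat.prime_iff_prime_int.mp hp.1).irreducible.coprime_iff_not_dvd.mpr ha).symm

namespace TorsionPairing

/-- The completely multiplicative function whose value at an odd prime `p` is the square root
of `p` that occurs in the quadratic Gauss sum modulo `p`. -/
noncomputable def gaussRoot (n : ℕ) : ℂ :=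
  (n.primeFactorsList.map fun p =>
    -- A prime factor is never 0; the case split only supplies the instance that makes ℤ/p finite.
    if h : p = 0 then 1 else
      haveI : NeZero p := ⟨h⟩
      (cyclic p 1).gaussSum * eighthRoot ^ (1 - p : ℤ)).prod

theorem gaussRoot_one : gaussRoot 1 = 1 := by simp [gaussRoot]

theorem gaussRoot_mul {m n : ℕ} (hm : m ≠ 0) (hn : n ≠ 0) :
    gaussRoot (m * n) = gaussRoot m * gaussRoot n := by
  rw [gaussRoot, ((Nat.perm_primeFactorsList_mul hm hn).map _).prod_eq, List.map_append,
    List.prod_append]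
  rfl

theorem gaussRoot_pow {m : ℕ} (hm : m ≠ 0) (k : ℕ) : gaussRoot (m ^ k) = gaussRoot m ^ k := by
  induction k with
  | zero => simp [gaussRoot_one]
  | succ k ih => rw [pow_succ, gaussRoot_mul (pow_ne_zero _ hm) hm, ih, pow_succ]

theorem gaussRoot_prod {ι : Type*} (s : Finset ι) (f : ι → ℕ) (hf : ∀ i ∈ s, f i ≠ 0) :
    gaussRoot (∏ i ∈ s, f i) = ∏ i ∈ s, gaussRoot (f i) := by
  classical
  induction s using Finset.induction_on with
  | empty => simp [gaussRoot_one]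
  | insert i s hi ih =>
    rw [Finset.prod_insert hi, Finset.prod_insert hi, gaussRoot_mul (hf i (by simp))
      (Finset.prod_ne_zero_iff.mpr fun j hj => hf j (by simp [hj])),
      ih fun j hj => hf j (by simp [hj])]

theorem gaussRoot_prime (p : ℕ) [hp : Fact p.Prime] :
    gaussRoot p = (cyclic p 1).gaussSum * eighthRoot ^ (1 - p : ℤ) := by
  simp [gaussRoot, Nat.primeFactorsList_prime hp.1, hp.1.ne_zero]

/-- The square of the Gauss sum is χ₄(p) p, and χ₄(p) = (-1)^((p-1)/2) = ζ^(2(p-1)), which the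
square of the twist ζ^(1-p) cancels. -/
theorem gaussRoot_prime_sq (p : ℕ) [hp : Fact p.Prime] (hodd : Odd p) : gaussRoot p ^ 2 = p := by
  obtain ⟨g, hg, h⟩ := exists_gaussSum_cyclic_prime p hodd
  have h1 : (cyclic p 1).gaussSum = g := by
    have := h 1 (by simp)
    rwa [jacobiSym.one_left, Int.cast_one, one_mul] at this
  rw [gaussRoot_prime, h1, mul_pow, hg, ZMod.χ₄_eq_neg_one_pow (Nat.odd_iff.mp hodd)]
  push_cast
  rw [neg_one_pow_eq_eighthRoot, ← zpow_natCast, ← zpow_mul, mul_right_comm,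
    ← zpow_add₀ eighthRoot_ne_zero]
  obtain ⟨m, hm⟩ := hodd
  have : (4 * ((p / 2 : ℕ) : ℤ) + (1 - p) * (2 : ℕ) : ℤ) = 0 := by
    have : p / 2 = m := by omega
    rw [this, hm]
    push_cast
    ring
  rw [this, zpow_zero, one_mul]

theorem gaussRoot_sq {n : ℕ} (hn : Odd n) : gaussRoot n ^ 2 = n := by
  induction n using Nat.recOnMul with
  | zero => exact absurd hn (by decide)
  | one => simp [gaussRoot_one]
  | prime p hp => exact have := Fact.mk hp; gaussRoot_prime_sq p hn
  | mul a b iha ihb =>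
    obtain ⟨ha, hb⟩ := Nat.odd_mul.mp hn
    rw [gaussRoot_mul ha.pos.ne' hb.pos.ne', mul_pow, iha ha, ihb hb, Nat.cast_mul]

theorem gaussSum_cyclic_prime (p : ℕ) [hp : Fact p.Prime] (hodd : Odd p) (a : ℤ)
    (ha : IsCoprime a p) :
    (cyclic p a).gaussSum = jacobiSym a p * gaussRoot p * eighthRoot ^ (p - 1 : ℤ) := by
  obtain ⟨g, -, h⟩ := exists_gaussSum_cyclic_prime p hodd
  have h1 : (cyclic p 1).gaussSum = g := by
    have := h 1 (by simp)
    rwa [jacobiSym.one_left, Int.cast_one, one_mul] at this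
  have ha' : (a : ZMod p) ≠ 0 := by
    rw [Ne, ZMod.intCast_zmod_eq_zero_iff_dvd]
    intro hd
    exact (Nat.prime_iff_prime_int.mp hp.1).not_isUnit (ha.isUnit_of_dvd' hd dvd_rfl)
  rw [h a ha', gaussRoot_prime, h1, mul_assoc, mul_assoc, ← zpow_add₀ eighthRoot_ne_zero]
  simp

theorem gaussSum_cyclic_one (a : ℤ) : (cyclic 1 a).gaussSum = 1 := by
  simp only [gaussSum, cyclic_apply, Subsingleton.elim (_ : ZMod 1) 0]
  simp

/-- Raising the exponent by 2 multiplies the Gauss sum and `gaussRoot` by p, and changes neither the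
Jacobi symbol nor the phase, because p² ≡ 1 mod 8. -/
theorem gaussSum_cyclic_prime_pow (p : ℕ) [hp : Fact p.Prime] (hodd : Odd p) (a : ℤ)
    (ha : IsCoprime a p) (k : ℕ) :
    (cyclic (p ^ k) a).gaussSum =
      jacobiSym a (p ^ k) * gaussRoot (p ^ k) * eighthRoot ^ ((p ^ k : ℕ) - 1 : ℤ) := by
  induction k using Nat.twoStepInduction with
  | zero =>
    -- The modulus occurs in the type and its instances, so it is generalized before being replaced.
    have h : ∀ (N : ℕ) [NeZero N], N = 1 → (cyclic N a).gaussSum = 1 := by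
      rintro N _ rfl
      convert gaussSum_cyclic_one a
    rw [h _ (pow_zero p)]
    simp [gaussRoot_one]
  | one =>
    have h : ∀ (N : ℕ) [NeZero N], N = p → (cyclic N a).gaussSum = (cyclic p a).gaussSum := by
      rintro N _ rfl
      convert rfl
    rw [h _ (pow_one p), gaussSum_cyclic_prime p hodd a ha, pow_one]
  | more k ih _ =>
    rw [gaussSum_cyclic_pow_add_two p hodd k a ha, ih]
    have h1 : jacobiSym a (p ^ (k + 2)) = jacobiSym a (p ^ k) := by
      rw [jacobiSym.pow_right, jacobiSym.pow_right, pow_add,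
        jacobiSym.sq_one (Int.isCoprime_iff_gcd_eq_one.mp ha), mul_one]
    have h2 : gaussRoot (p ^ (k + 2)) = p * gaussRoot (p ^ k) := by
      rw [gaussRoot_pow hp.1.ne_zero, gaussRoot_pow hp.1.ne_zero, pow_add, gaussRoot_prime_sq p hodd,
        mul_comm]
    have h3 : eighthRoot ^ ((p ^ (k + 2) : ℕ) - 1 : ℤ) = eighthRoot ^ ((p ^ k : ℕ) - 1 : ℤ) := by
      refine eighthRoot_zpow_congr ?_
      have : (((p ^ (k + 2) : ℕ) - 1) - ((p ^ k : ℕ) - 1) : ℤ) = p ^ k * (p ^ 2 - 1) := by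
        push_cast
        ring
      rw [this]
      exact (Int.eight_dvd_sq_sub_one_of_odd (by exact_mod_cast hodd)).mul_left _
    rw [h1, h2, h3]
    ring

/-- Quadratic reciprocity as a phase: the sign is (-1)^(mn) = ζ^(4mn) with M = 2m + 1 and N = 2n +
1. -/
theorem jacobiSym_mul_jacobiSym {M N : ℕ} (hM : Odd M) (hN : Odd N) (hMN : M.Coprime N) :
    (jacobiSym N M * jacobiSym M N : ℂ) = eighthRoot ^ ((M - 1) * (N - 1) : ℤ) := by
  have hsq : (jacobiSym N M : ℂ) * jacobiSym N M = 1 := by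
    have := jacobiSym.sq_one (a := N) (b := M) (by simpa using hMN.symm)
    rw [sq] at this
    exact_mod_cast this
  rw [jacobiSym.quadratic_reciprocity hM hN]
  push_cast
  rw [mul_left_comm, hsq, mul_one, neg_one_pow_eq_eighthRoot]
  obtain ⟨m, rfl⟩ := hM
  obtain ⟨n, rfl⟩ := hN
  congr 1
  have h1 : (2 * m + 1) / 2 = m := by omega
  have h2 : (2 * n + 1) / 2 = n := by omega
  rw [h1, h2]
  push_cast
  ring

/-- The Gauss sums of the nondegenerate pairings on `ℤ/N` for odd `N`. -/
theorem gaussSum_cyclic (N : ℕ) [NeZero N] (hN : Odd N) (a : ℤ) (ha : IsCoprime a N) :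
    (cyclic N a).gaussSum = jacobiSym a N * gaussRoot N * eighthRoot ^ (N - 1 : ℤ) := by
  suffices h : ∀ N : ℕ, Odd N → ∀ (_ : NeZero N) (a : ℤ), IsCoprime a N → (cyclic N a).gaussSum =
      jacobiSym a N * gaussRoot N * eighthRoot ^ (N - 1 : ℤ) from h N hN _ a ha
  clear! N a
  intro N hN inst a ha
  induction N using Nat.recOnPosPrimePosCoprime generalizing a with
  | zero => exact absurd hN (by decide)
  | one =>
    convert gaussSum_cyclic_one a
    simp [gaussRoot_one]
  | prime_pow p k hp hk =>
    have := Fact.mk hp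
    have hp' : Odd p := (Nat.odd_pow_iff hk.ne').mp hN
    convert gaussSum_cyclic_prime_pow p hp' a ?_ k
    push_cast at ha
    exact (IsCoprime.pow_right_iff hk).mp ha
  | coprime M N hM1 hN1 hMN ihM ihN =>
    have : NeZero M := ⟨by omega⟩
    have : NeZero N := ⟨by omega⟩
    obtain ⟨hM, hN⟩ := Nat.odd_mul.mp hN
    push_cast at ha
    obtain ⟨haM, haN⟩ := IsCoprime.mul_right_iff.mp ha
    have hc : IsCoprime (M : ℤ) N := Nat.isCoprime_iff_coprime.mpr hMN
    have h := gaussSum_cyclic_mul M N hM hN hMN a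
    rw [ihM hM _ _ (haM.mul_left hc.symm), ihN hN _ _ (haN.mul_left hc)] at h
    rw [← h, gaussRoot_mul (NeZero.ne M) (NeZero.ne N), jacobiSym.mul_left, jacobiSym.mul_left,
      jacobiSym.mul_right]
    have hQ := jacobiSym_mul_jacobiSym hM hN hMN
    -- The cross term (M - 1)(N - 1) is exactly the phase given by reciprocity.
    have hexp : ((M * N : ℕ) - 1 : ℤ) = (M - 1) * (N - 1) + (M - 1) + (N - 1) := by
      push_cast
      ring
    rw [hexp, zpow_add₀ eighthRoot_ne_zero, zpow_add₀ eighthRoot_ne_zero, ← hQ]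
    push_cast
    ring

/-- The Gauss sum of the linking pairing of the rank one lattice of odd determinant `a`. -/
theorem gaussSum_cyclic_natAbs (a : ℤ) [NeZero a.natAbs] (ha : Odd a) :
    (cyclic a.natAbs a.sign).gaussSum = gaussRoot a.natAbs * eighthRoot ^ (a - a.sign) := by
  have hN : Odd a.natAbs := Int.natAbs_odd.mpr ha
  have ha0 : a ≠ 0 := fun h => by simp [h] at ha
  rcases lt_or_gt_of_ne ha0 with h | h
  · rw [gaussSum_cyclic _ hN, Int.sign_eq_neg_one_of_neg h, jacobiSym.at_neg_one hN,
      ZMod.χ₄_eq_neg_one_pow (Nat.odd_iff.mp hN)]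
    · push_cast
      rw [neg_one_pow_eq_eighthRoot, mul_comm _ (gaussRoot _), mul_assoc,
        ← zpow_add₀ eighthRoot_ne_zero]
      congr 1
      -- With |a| = 2m + 1 the exponents are 4m + 2m and -2m, which differ by 8m.
      refine eighthRoot_zpow_congr ?_
      obtain ⟨m, hm⟩ := hN
      have h1 : a.natAbs / 2 = m := by omega
      have h2 : |a| = -a := abs_of_neg h
      rw [h1, h2]
      omega
    · rw [Int.sign_eq_neg_one_of_neg h]
      exact isCoprime_one_left.neg_left
  · rw [gaussSum_cyclic _ hN, Int.sign_eq_one_of_pos h, jacobiSym.one_left]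
    · rw [Int.natAbs_of_nonneg h.le]
      simp
    · rw [Int.sign_eq_one_of_pos h]
      exact isCoprime_one_left

/-- A pairing on `ℤ/N` with `b g g = a / N` for a generator `g` has the Gauss sum of the cyclic
pairing. -/
theorem gaussSum_eq_cyclic (N : ℕ) [NeZero N] (b : TorsionPairing (ZMod N)) (g : ZMod N) (a : ℤ)
    (hg : AddSubgroup.zmultiples g = ⊤)
    (hb : b g g = (((a : ℚ) / (N : ℚ) : ℚ) : AddCircle (1 : ℚ))) :
    b.gaussSum = (cyclic N a).gaussSum := by
  have hsurj : Function.Surjective fun x : ZMod N => x * g := by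
    intro y
    obtain ⟨m, hm⟩ := AddSubgroup.mem_zmultiples_iff.mp (hg ▸ AddSubgroup.mem_top y)
    exact ⟨m, by simpa using hm⟩
  symm
  refine gaussSum_congr (Equiv.ofBijective _ (Finite.surjective_iff_bijective.mp hsurj)) ?_
  intro x
  obtain ⟨m, rfl⟩ := ZMod.intCast_surjective x
  have : ∀ m : ℤ, (m : ZMod N) * g = m • g := fun m => by simp
  rw [Equiv.ofBijective_apply, this, cyclic_intCast, LinearMap.map_smul₂, LinearMap.map_smul, hb,
    ← AddCircle.coe_zsmul, ← AddCircle.coe_zsmul]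
  congr 1
  simp only [zsmul_eq_mul]
  ring

/-- Modulo 8, p^k is p for odd k and 1 for even k; likewise the k-th power of the Legendre symbol
depends only on the parity of k. -/
theorem gaussSum_of_generator {p k : ℕ} [hp : Fact p.Prime] (hodd : Odd p) [NeZero (p ^ k)]
    {b : TorsionPairing (ZMod (p ^ k))} {g : ZMod (p ^ k)} {a : ℤ}
    (hg : AddSubgroup.zmultiples g = ⊤)
    (hb : b g g = (((a : ℚ) / (p : ℚ) ^ k : ℚ) : AddCircle (1 : ℚ))) (ha : (a : ZMod p) ≠ 0) :
    b.gaussSum = gaussRoot (p ^ k) *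
      if Odd k then legendreSym p a * eighthRoot ^ (p - 1 : ℤ) else 1 := by
  have hcop := isCoprime_of_intCast_ne_zero ha
  rw [gaussSum_eq_cyclic _ b g a hg (by rw [hb, Nat.cast_pow]),
    gaussSum_cyclic _ hodd.pow a (by push_cast; exact hcop.pow_right), jacobiSym.pow_right,
    ← jacobiSym.legendreSym.to_jacobiSym, mul_comm (_ : ℂ) (gaussRoot _), mul_assoc]
  have hsq : legendreSym p a ^ 2 = 1 := legendreSym.sq_one p ha
  have h8 : (8 : ℤ) ∣ p ^ 2 - 1 := Int.eight_dvd_sq_sub_one_of_odd (by exact_mod_cast hodd)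
  have hpow : ∀ m : ℕ, (8 : ℤ) ∣ (p ^ 2) ^ m - 1 := fun m => by
    simpa using h8.trans (sub_dvd_pow_sub_pow ((p : ℤ) ^ 2) 1 m)
  congr 1
  split_ifs with hk
  · obtain ⟨m, rfl⟩ := hk
    rw [pow_succ, pow_mul, hsq, one_pow, one_mul]
    congr 1
    refine eighthRoot_zpow_congr ?_
    have : (((p ^ (2 * m + 1) : ℕ) - 1) - (p - 1) : ℤ) = p * ((p ^ 2) ^ m - 1) := by
      push_cast
      ring
    rw [this]
    exact (hpow m).mul_left _
  · obtain ⟨m, rfl⟩ := even_iff_two_dvd.mp (Nat.not_odd_iff_even.mp hk)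
    rw [pow_mul, hsq, one_pow, Int.cast_one, one_mul, eighthRoot_zpow_eq_one_iff]
    push_cast
    rw [pow_mul]
    exact hpow m

theorem gaussSum_of_isTypeA {p k : ℕ} (hp : p.Prime) (hodd : Odd p) [NeZero (p ^ k)]
    {b : TorsionPairing (ZMod (p ^ k))} (hb : IsTypeA p k b) :
    b.gaussSum = gaussRoot (p ^ k) * eighthRoot ^ (if Odd k then (p - 1 : ℤ) else 0) := by
  have := Fact.mk hp
  obtain ⟨g, a, hg, hgg, ha0, ha⟩ := hb
  rw [gaussSum_of_generator hodd hg hgg ha0, (legendreSym.eq_one_iff p ha0).mpr ha]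
  split_ifs <;> simp

theorem gaussSum_of_isTypeB {p k : ℕ} (hp : p.Prime) (hodd : Odd p) [NeZero (p ^ k)]
    {b : TorsionPairing (ZMod (p ^ k))} (hb : IsTypeB p k b) :
    b.gaussSum = gaussRoot (p ^ k) * eighthRoot ^ (if Odd k then (p - 5 : ℤ) else 0) := by
  have := Fact.mk hp
  obtain ⟨g, a, hg, hgg, ha⟩ := hb
  have ha0 : (a : ZMod p) ≠ 0 := fun h => ha (h ▸ IsSquare.zero)
  rw [gaussSum_of_generator hodd hg hgg ha0, (legendreSym.eq_neg_one_iff p).mpr ha]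
  split_ifs
  -- The symbol -1 equals ζ^4, and 4 + (p - 1) ≡ p - 5 mod 8: this is where the 5 comes from.
  · rw [Int.cast_neg, Int.cast_one, ← eighthRoot_zpow_four, ← zpow_add₀ eighthRoot_ne_zero]
    congr 1
    exact eighthRoot_zpow_congr ⟨1, by ring⟩
  · simp

end TorsionPairing

/-! ### Orthogonal families with odd norms. -/

open Module in
/-- A nondegenerate symmetric form over `𝔽₂` with a vector `v` with `B v v = 1` has such a vector
whose orthogonal complement contains another one, unless the dimension is one. -/
theorem exists_orthonormal_pair_zmod_two {V : Type*} [AddCommGroup V] [Module (ZMod 2) V]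
    [FiniteDimensional (ZMod 2) V] (B : LinearMap.BilinForm (ZMod 2) V) (hs : B.IsSymm)
    (hB : B.Nondegenerate) (hv : ∃ v, B v v = 1) (hd : 1 < finrank (ZMod 2) V) :
    ∃ v u, B v v = 1 ∧ B v u = 0 ∧ B u u = 1 := by
  have h01 : ∀ c : ZMod 2, c ≠ 0 → c = 1 := by decide
  obtain ⟨v, hv⟩ := hv
  by_contra! hcon
  have halt : ∀ u, B v u = 0 → B u u = 0 := fun u hu => by
    by_contra h
    exact hcon v u hv hu (h01 _ h)
  have hv0 : B v v ≠ 0 := by rw [hv]; exact one_ne_zero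
  have hcompl := LinearMap.BilinForm.isCompl_span_singleton_orthogonal hv0
  have hfin := Submodule.finrank_add_eq_of_isCompl hcompl
  rw [finrank_span_singleton (fun h : v = 0 => by simp [h] at hv)] at hfin
  obtain ⟨⟨u, hu⟩, hu0⟩ : ∃ u : B.orthogonal (ZMod 2 ∙ v), u ≠ 0 := by
    have : Nontrivial (B.orthogonal (ZMod 2 ∙ v)) := nontrivial_of_finrank_pos (R := ZMod 2) (by omega)
    exact exists_ne 0
  have hn := LinearMap.BilinForm.restrict_nondegenerate_orthogonal_spanSingleton B hB hs.isRefl hv0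
  obtain ⟨⟨w, hw⟩, huw⟩ : ∃ w : B.orthogonal (ZMod 2 ∙ v), B u w ≠ 0 := by
    by_contra! h
    exact hu0 (hn.1 ⟨u, hu⟩ fun w => h w)
  replace hu : B v u = 0 := hu v (Submodule.mem_span_singleton_self v)
  replace hw : B v w = 0 := hw v (Submodule.mem_span_singleton_self v)
  replace huw : B u w = 1 := h01 _ huw
  have huv : B u v = 0 := by rw [hs.eq, hu]
  have hwv : B w v = 0 := by rw [hs.eq, hw]
  have h11 : (1 + 1 : ZMod 2) = 0 := by decide
  -- If the complement of v were alternating, it would contain u, w with product 1. Then v + u and v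
  -- + w have norm 1 and product 1 + 1 = 0, a contradiction.
  refine hcon (v + u) (v + w) ?_ ?_ ?_ <;>
    simp [hv, hu, hw, huw, huv, hwv, halt u hu, halt w hw, h11]

open Module in
/-- A nondegenerate symmetric form over `𝔽₂` that is not alternating has an orthonormal family of
full size. -/
theorem exists_orthonormal_zmod_two {V : Type*} [AddCommGroup V] [Module (ZMod 2) V]
    [FiniteDimensional (ZMod 2) V] (B : LinearMap.BilinForm (ZMod 2) V) (hs : B.IsSymm)
    (hB : B.Nondegenerate) (hv : ∃ v, B v v = 1) {d : ℕ} (hd : finrank (ZMod 2) V = d) :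
    ∃ w : Fin d → V, ∀ i j, B (w i) (w j) = if i = j then 1 else 0 := by
  induction d generalizing V with
  | zero => exact ⟨Fin.elim0, fun i => i.elim0⟩
  | succ d ih =>
    -- The vector v must be chosen so that its complement is again not alternating, or the induction
    -- would stop; in dimension one the complement is zero and nothing is required.
    obtain ⟨v, hv1, hu⟩ : ∃ v, B v v = 1 ∧ (d ≠ 0 → ∃ u, B v u = 0 ∧ B u u = 1) := by
      rcases Nat.eq_zero_or_pos d with h0 | h0
      · obtain ⟨v, hv⟩ := hv
        exact ⟨v, hv, fun h => absurd h0 h⟩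
      · obtain ⟨v, u, h1, h2, h3⟩ := exists_orthonormal_pair_zmod_two B hs hB hv (by omega)
        exact ⟨v, h1, fun _ => ⟨u, h2, h3⟩⟩
    have hv0 : B v v ≠ 0 := by rw [hv1]; exact one_ne_zero
    have hcompl := LinearMap.BilinForm.isCompl_span_singleton_orthogonal hv0
    have hfin := Submodule.finrank_add_eq_of_isCompl hcompl
    rw [finrank_span_singleton (fun h : v = 0 => by simp [h] at hv1)] at hfin
    have hmem : ∀ u, u ∈ B.orthogonal (ZMod 2 ∙ v) ↔ B v u = 0 := by
      intro u
      refine ⟨fun h => h v (Submodule.mem_span_singleton_self v), fun h x hx => ?_⟩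
      obtain ⟨c, rfl⟩ := Submodule.mem_span_singleton.mp hx
      simp [h]
    have hn := LinearMap.BilinForm.restrict_nondegenerate_orthogonal_spanSingleton B hB hs.isRefl
      hv0
    obtain ⟨w, hw⟩ : ∃ w : Fin d → B.orthogonal (ZMod 2 ∙ v),
        ∀ i j, B (w i) (w j) = if i = j then 1 else 0 := by
      rcases Nat.eq_zero_or_pos d with rfl | h0
      · exact ⟨Fin.elim0, fun i => i.elim0⟩
      · obtain ⟨u, h1, h2⟩ := hu h0.ne'
        exact ih (B.restrict (B.orthogonal (ZMod 2 ∙ v))) ⟨fun x y => hs.eq x y⟩ hn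
          ⟨⟨u, (hmem u).mpr h1⟩, h2⟩ (by omega)
    refine ⟨Fin.cons v fun i => w i, fun i j => ?_⟩
    refine Fin.cases ?_ (fun i => ?_) i <;> refine Fin.cases ?_ (fun j => ?_) j
    · simp [hv1]
    · simpa [(Fin.succ_ne_zero j).symm] using (hmem _).mp (w j).2
    · rw [hs.eq]
      simpa using (hmem _).mp (w i).2
    · simpa using hw i j

/-- Gram–Schmidt orthogonalization of a family that is orthonormal modulo `2`. -/
theorem exists_orthogonal_of_orthonormal_mod_two {V : Type*} [AddCommGroup V]
    (B : LinearMap.BilinForm ℤ V) (hs : ∀ x y, B x y = B y x) {m : ℕ} (w : Fin m → V)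
    (hodd : ∀ i, Odd (B (w i) (w i))) (heven : ∀ i j, i ≠ j → Even (B (w i) (w j))) :
    ∃ e : Fin m → V, (∀ i, ∃ u, e i = w i + (2 : ℤ) • u) ∧ (∀ i, Odd (B (e i) (e i))) ∧
      ∀ i j, i ≠ j → B (e i) (e j) = 0 := by
  induction m with
  | zero => exact ⟨w, fun i => i.elim0, fun i => i.elim0, fun i => i.elim0⟩
  | succ m ih =>
    obtain ⟨e, hew, hee, he⟩ := ih (fun i => w i.castSucc) (fun i => hodd _)
      fun i j hij => heven _ _ fun h => hij (Fin.castSucc_injective m h)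
    set z := w (Fin.last m)
    -- Each e_i is congruent to w_i modulo 2, so its product with the new vector is still even.
    have hc : ∀ i, ∃ c, B z (e i) = 2 * c := fun i => by
      obtain ⟨u, hu⟩ := hew i
      obtain ⟨c, hc⟩ := heven (Fin.last m) i.castSucc (Fin.castSucc_lt_last i).ne'
      refine ⟨c + B z u, ?_⟩
      rw [hu, map_add, hc, map_smul, smul_eq_mul]
      ring
    choose c hc using hc
    obtain ⟨a, ha⟩ : Odd (∏ i, B (e i) (e i)) :=
      Finset.prod_induction _ _ (fun _ _ => Odd.mul) odd_one fun i _ => hee i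
    -- Gram–Schmidt multiplied through by the product of the previous norms. That product is odd and
    -- the B z (e j) are even, so y ≡ z modulo 2.
    let y : V := (∏ i, B (e i) (e i)) • z -
      ∑ j, (B z (e j) * ∏ i ∈ Finset.univ.erase j, B (e i) (e i)) • e j
    have hy : ∀ i, B y (e i) = 0 := by
      intro i
      simp only [y, map_sub, map_sum, LinearMap.sub_apply, LinearMap.sum_apply, map_smul,
        LinearMap.smul_apply, smul_eq_mul]
      rw [Finset.sum_eq_single i (fun j _ hj => by rw [he j i hj, mul_zero]) (by simp),
        mul_assoc, Finset.prod_erase_mul _ _ (Finset.mem_univ i)]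
      ring
    obtain ⟨u, hu⟩ : ∃ u, y = z + (2 : ℤ) • u := by
      refine ⟨a • z - ∑ j, (c j * ∏ i ∈ Finset.univ.erase j, B (e i) (e i)) • e j, ?_⟩
      simp only [y, ha, hc]
      rw [smul_sub, Finset.smul_sum]
      simp only [smul_smul, ← mul_assoc]
      module
    have hyy : Odd (B y y) := by
      have : B y y = B z z + 2 * (2 * B z u + 2 * B u u) := by
        rw [hu]
        simp only [map_add, LinearMap.add_apply, map_smul, LinearMap.smul_apply, smul_eq_mul,
          hs u z]
        ring
      rw [this]
      exact (hodd (Fin.last m)).add_even (even_two_mul _)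
    refine ⟨Fin.snoc e y, fun i => ?_, fun i => ?_, fun i j hij => ?_⟩
    · refine Fin.lastCases ?_ (fun i => ?_) i
      · exact ⟨u, by simpa using hu⟩
      · simpa using hew i
    · refine Fin.lastCases ?_ (fun i => ?_) i
      · simpa using hyy
      · simpa using hee i
    · revert hij
      refine Fin.lastCases ?_ (fun i => ?_) i <;> refine Fin.lastCases ?_ (fun j => ?_) j
      · exact fun h => absurd rfl h
      · intro _
        simpa using hy j
      · intro _
        rw [hs]
        simpa using hy i
      · intro hij
        simpa using he i j fun h => hij (by rw [h])

namespace LinearMap.BilinForm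

variable {R V : Type*} [CommRing R] [AddCommGroup V] [Module R V]

/-- The orthogonal sum of a bilinear form with the form `⟨1⟩` of rank one. -/
def addOne (B : LinearMap.BilinForm R V) : LinearMap.BilinForm R (V × R) :=
  B.compl₁₂ (LinearMap.fst R V R) (LinearMap.fst R V R) +
    (LinearMap.mul R R).compl₁₂ (LinearMap.snd R V R) (LinearMap.snd R V R)

theorem addOne_apply (B : LinearMap.BilinForm R V) (x y : V × R) :
    B.addOne x y = B x.1 y.1 + x.2 * y.2 := rfl

theorem addOne_comm {B : LinearMap.BilinForm R V} (hB : ∀ x y, B x y = B y x) (x y : V × R) :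
    B.addOne x y = B.addOne y x := by
  rw [addOne_apply, addOne_apply, hB, mul_comm]

theorem nondegenerate_addOne {B : LinearMap.BilinForm R V} (hB : ∀ x y, B x y = B y x)
    (h : B.Nondegenerate) : B.addOne.Nondegenerate := by
  have hl : ∀ x, (∀ y, B.addOne x y = 0) → x = 0 := by
    intro x hx
    refine Prod.ext (h.1 x.1 fun y => ?_) ?_
    · simpa [addOne_apply] using hx (y, 0)
    · simpa [addOne_apply] using hx (0, 1)
  exact ⟨hl, fun y hy => hl y fun x => by rw [addOne_comm hB, hy]⟩

end LinearMap.BilinForm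

namespace IntegralLattice

variable {n : ℕ} (L : IntegralLattice n)

/-- The map from `ℤⁿ ⊕ ℤ` to its extension of scalars. -/
def castVec (K : Type*) [Field K] (x : (Fin n → ℤ) × ℤ) : (Fin n → K) × K :=
  (fun i => (x.1 i : K), (x.2 : K))

theorem addOne_castVec (K : Type*) [Field K] (x y : (Fin n → ℤ) × ℤ) :
    (L.extend K).addOne (castVec K x) (castVec K y) = (L.form.addOne x y : K) := by
  rw [LinearMap.BilinForm.addOne_apply, LinearMap.BilinForm.addOne_apply, castVec, castVec,
    L.extend_intCast]
  push_cast
  rfl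

theorem extend_nondegenerate (K : Type*) [Field K] (h : (L.det : K) ≠ 0) :
    (L.extend K).Nondegenerate := by
  rw [extend, LinearMap.BilinForm.nondegenerate_toBilin'_iff_det_ne_zero]
  rw [det] at h
  have := RingHom.map_det (Int.castRingHom K) L.gram
  rw [eq_intCast] at this
  rwa [this] at h

/-- If `L` has odd determinant then `L ⊕ ⟨1⟩` contains an orthogonal family of full size of
vectors with odd norms. -/
theorem exists_orthogonal_odd (hδ : Odd L.det) :
    ∃ e : Fin (n + 1) → (Fin n → ℤ) × ℤ, (∀ i, Odd (L.form.addOne (e i) (e i))) ∧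
      ∀ i j, i ≠ j → L.form.addOne (e i) (e j) = 0 := by
  have h2 : (L.det : ZMod 2) ≠ 0 := by
    rw [ZMod.intCast_eq_one_iff_odd.mpr hδ]
    exact one_ne_zero
  have hsymm : ∀ x y, L.form x y = L.form y x := fun x y => L.symm.eq x y
  obtain ⟨w, hw⟩ := exists_orthonormal_zmod_two (L.extend (ZMod 2)).addOne
    ⟨LinearMap.BilinForm.addOne_comm (L.extend_comm (ZMod 2))⟩
    (LinearMap.BilinForm.nondegenerate_addOne (L.extend_comm _) (L.extend_nondegenerate _ h2))
    -- The generator of ⟨1⟩ shows that the form modulo 2 is not alternating, even if L is even.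
    ⟨(0, 1), by simp [LinearMap.BilinForm.addOne_apply]⟩ (d := n + 1) (by simp)
  have hlift : ∀ i, ∃ v : (Fin n → ℤ) × ℤ, castVec (ZMod 2) v = w i := fun i => by
    choose f hf using fun j => ZMod.intCast_surjective ((w i).1 j)
    obtain ⟨t, ht⟩ := ZMod.intCast_surjective (w i).2
    exact ⟨(f, t), Prod.ext (funext hf) ht⟩
  choose v hv using hlift
  have hvv : ∀ i j, ((L.form.addOne (v i) (v j) : ℤ) : ZMod 2) = if i = j then 1 else 0 :=
    fun i j => by rw [← addOne_castVec, hv, hv, hw]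
  obtain ⟨e, -, h1, h2⟩ := exists_orthogonal_of_orthonormal_mod_two L.form.addOne
    (LinearMap.BilinForm.addOne_comm hsymm) v
    (fun i => (ZMod.intCast_eq_one_iff_odd).mp (by rw [hvv, if_pos rfl]))
    (fun i j hij => (ZMod.intCast_eq_zero_iff_even).mp (by rw [hvv, if_neg hij]))
  exact ⟨e, h1, h2⟩

end IntegralLattice

/-! ### Expansions in orthogonal families and the signature. -/

section Orthogonal

open Module

variable {K V ι : Type*} [Field K] [AddCommGroup V] [Module K V] [Fintype ι]

theorem exists_basis_of_orthogonal [FiniteDimensional K V] (B : LinearMap.BilinForm K V) (e : ι → V)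
    (he : ∀ i j, i ≠ j → B (e i) (e j) = 0) (h0 : ∀ i, B (e i) (e i) ≠ 0)
    (hcard : Fintype.card ι = finrank K V) : ∃ b : Basis ι K V, ∀ i, b i = e i :=
  ⟨basisOfLinearIndependentOfCardEqFinrank' e
    (LinearMap.linearIndependent_of_isOrthoᵢ (B := B) (fun i j hij => he i j hij) h0) hcard,
    fun i => by simp⟩

/-- Expansion of a vector in an orthogonal family of full size. -/
theorem eq_sum_of_orthogonal [FiniteDimensional K V] (B : LinearMap.BilinForm K V) (e : ι → V)
    (he : ∀ i j, i ≠ j → B (e i) (e j) = 0) (h0 : ∀ i, B (e i) (e i) ≠ 0)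
    (hcard : Fintype.card ι = finrank K V) (x : V) :
    x = ∑ i, (B x (e i) / B (e i) (e i)) • e i := by
  obtain ⟨b, hb⟩ := exists_basis_of_orthogonal B e he h0 hcard
  have hx : x = ∑ i, b.repr x i • e i := by
    simpa only [hb] using (b.sum_repr x).symm
  have hc : ∀ i, B x (e i) = b.repr x i * B (e i) (e i) := fun i => by
    conv_lhs => rw [hx]
    rw [LinearMap.map_sum₂, Finset.sum_eq_single i
      (fun j _ hj => by rw [LinearMap.map_smul₂, he j i hj, smul_zero]) (by simp),
      LinearMap.map_smul₂, smul_eq_mul]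
  conv_lhs => rw [hx]
  exact Finset.sum_congr rfl fun i _ => by rw [hc, mul_div_cancel_right₀ _ (h0 i)]

theorem apply_eq_sum_of_orthogonal [FiniteDimensional K V] (B : LinearMap.BilinForm K V)
    (hs : ∀ x y, B x y = B y x) (e : ι → V)
    (he : ∀ i j, i ≠ j → B (e i) (e j) = 0) (h0 : ∀ i, B (e i) (e i) ≠ 0)
    (hcard : Fintype.card ι = finrank K V) (x y : V) :
    B x y = ∑ i, B x (e i) * B y (e i) / B (e i) (e i) := by
  conv_lhs => rw [eq_sum_of_orthogonal B e he h0 hcard x]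
  rw [LinearMap.map_sum₂]
  refine Finset.sum_congr rfl fun i _ => ?_
  rw [LinearMap.map_smul₂, smul_eq_mul, hs (e i) y]
  ring

/-- Sylvester's law of inertia, applied to the diagonal form given by the basis. Zero diagonal
entries are allowed and contribute nothing to either side. -/
theorem sigPos_sub_sigNeg_of_basis {V : Type*} [AddCommGroup V] [Module ℝ V]
    (B : LinearMap.BilinForm ℝ V) (hs : ∀ x y, B x y = B y x) (b : Basis ι ℝ V)
    (hb : ∀ i j, i ≠ j → B (b i) (b j) = 0) :
    (sigPos B.toQuadraticMap : ℤ) - sigNeg B.toQuadraticMap =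
      ∑ i, (SignType.sign (B (b i) (b i)) : ℤ) := by
  classical
  have hassoc : (QuadraticMap.associated (R := ℝ) B.toQuadraticMap) = B :=
    QuadraticMap.associated_left_inverse ℝ hs
  have hE : QuadraticMap.Equivalent B.toQuadraticMap
      (QuadraticMap.weightedSumSquares ℝ fun i => B (b i) (b i)) := by
    have := QuadraticMap.basisRepr_eq_of_iIsOrtho B.toQuadraticMap b
      (by rw [hassoc]; exact fun i j hij => hb i j hij)
    have h2 := QuadraticMap.isometryEquivBasisRepr B.toQuadraticMap b
    rw [this] at h2
    exact ⟨h2⟩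
  rw [QuadraticForm.sigPos_of_equiv_weightedSumSquares hE,
    QuadraticForm.sigNeg_of_equiv_weightedSumSquares hE, Set.ncard_eq_toFinset_card',
    Set.ncard_eq_toFinset_card', Set.toFinset_ofPred, Set.toFinset_ofPred, Finset.card_filter,
    Finset.card_filter]
  push_cast
  rw [← Finset.sum_sub_distrib]
  refine Finset.sum_congr rfl fun i _ => ?_
  rcases lt_trichotomy (B (b i) (b i)) 0 with h | h | h
  · simp [h, h.le]
  · simp [h]
  · simp [h, h.le]

theorem sigPos_sub_sigNeg_addOne {V : Type*} [AddCommGroup V] [Module ℝ V] [FiniteDimensional ℝ V]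
    (B : LinearMap.BilinForm ℝ V) (hs : ∀ x y, B x y = B y x) :
    (sigPos B.addOne.toQuadraticMap : ℤ) - sigNeg B.addOne.toQuadraticMap =
      sigPos B.toQuadraticMap - sigNeg B.toQuadraticMap + 1 := by
  obtain ⟨b, hb⟩ := LinearMap.BilinForm.exists_orthogonal_basis (B := B) ⟨hs⟩
  rw [sigPos_sub_sigNeg_of_basis B hs b fun i j hij => hb hij,
    sigPos_sub_sigNeg_of_basis B.addOne (LinearMap.BilinForm.addOne_comm hs)
      (b.prod (Basis.singleton Unit ℝ))]
  · simp [LinearMap.BilinForm.addOne_apply]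
  · rintro (i | i) (j | j) hij
    · simpa [LinearMap.BilinForm.addOne_apply] using hb fun h => hij (by rw [h])
    · simp [LinearMap.BilinForm.addOne_apply]
    · simp [LinearMap.BilinForm.addOne_apply]
    · exact absurd rfl hij

end Orthogonal

/-! ### Comparison of the linking pairing with that of a diagonal sublattice. -/

namespace IntegralLattice

open LinearMap.BilinForm

variable {n : ℕ} (L : IntegralLattice n)

theorem signature_add_one (e : Fin (n + 1) → (Fin n → ℤ) × ℤ)
    (h0 : ∀ i, L.form.addOne (e i) (e i) ≠ 0)
    (he : ∀ i j, i ≠ j → L.form.addOne (e i) (e j) = 0) :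
    L.signature + 1 = ∑ i, (L.form.addOne (e i) (e i)).sign := by
  obtain ⟨b, hb⟩ := exists_basis_of_orthogonal (L.extend ℝ).addOne (fun i => castVec ℝ (e i))
    (fun i j hij => by rw [addOne_castVec, he i j hij, Int.cast_zero])
    (fun i => by rw [addOne_castVec]; exact_mod_cast h0 i) (by simp)
  rw [signature, ← sigPos_sub_sigNeg_addOne _ (L.extend_comm ℝ),
    sigPos_sub_sigNeg_of_basis _ (addOne_comm (L.extend_comm ℝ)) b fun i j hij => by
      rw [hb, hb, addOne_castVec, he i j hij, Int.cast_zero]]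
  refine Finset.sum_congr rfl fun i _ => ?_
  rw [hb, addOne_castVec, Int.sign_eq_sign]
  congr 1
  rcases lt_trichotomy (L.form.addOne (e i) (e i)) 0 with h | h | h
  · rw [sign_neg h, sign_neg (by exact_mod_cast h)]
  · exact absurd h (h0 i)
  · rw [sign_pos h, sign_pos (by exact_mod_cast h)]

theorem mem_integral_iff (x : Fin n → ℚ) : x ∈ integral n ↔ ∃ m : Fin n → ℤ, (fun i => (m i : ℚ)) = x :=
  Iff.rfl

theorem mem_dual_iff (x : Fin n → ℚ) :
    x ∈ L.dual ↔ ∀ m : Fin n → ℤ, ∃ k : ℤ, (k : ℚ) = L.extend ℚ x fun i => (m i : ℚ) := by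
  constructor
  · intro hx m
    exact Submodule.mem_one.mp (hx _ ⟨m, rfl⟩)
  · rintro hx _ ⟨m, rfl⟩
    exact Submodule.mem_one.mpr (hx m)

/-- The Gauss sum of the linking pairing is determined by an orthogonal sublattice of full rank
of `L ⊕ ⟨1⟩` with odd determinant. -/
theorem exists_gaussSum_directSum_eq (e : Fin (n + 1) → (Fin n → ℤ) × ℤ)
    (hodd : ∀ i, Odd (L.form.addOne (e i) (e i)))
    (he : ∀ i j, i ≠ j → L.form.addOne (e i) (e j) = 0)
    [∀ i, NeZero (L.form.addOne (e i) (e i)).natAbs]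
    {H : Type*} [AddCommGroup H] [Fintype H] (c : TorsionPairing H)
    (hL : TorsionPairing.Isomorphic L.linkingPairing c) :
    ∃ h : ℕ, (TorsionPairing.directSum fun i =>
      TorsionPairing.cyclic (L.form.addOne (e i) (e i)).natAbs
        (L.form.addOne (e i) (e i)).sign).gaussSum = h * c.gaussSum := by
  set a : Fin (n + 1) → ℤ := fun i => L.form.addOne (e i) (e i) with ha
  have ha0 : ∀ i, a i ≠ 0 := fun i => Int.natAbs_ne_zero.mp (NeZero.ne (a i).natAbs)
  have haq : ∀ i, (a i : ℚ) ≠ 0 := fun i => by exact_mod_cast ha0 i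
  set β := (L.extend ℚ).addOne with hβ
  set f : Fin (n + 1) → (Fin n → ℚ) × ℚ := fun i => castVec ℚ (e i) with hf
  have hβs : ∀ x y, β x y = β y x := addOne_comm (L.extend_comm ℚ)
  have hff : ∀ i, β (f i) (f i) = a i := fun i => addOne_castVec L ℚ _ _
  have hfo : ∀ i j, i ≠ j → β (f i) (f j) = 0 := fun i j hij => by
    rw [hβ, hf, addOne_castVec, he i j hij, Int.cast_zero]
  have hf0 : ∀ i, β (f i) (f i) ≠ 0 := fun i => by rw [hff]; exact haq i
  have hexp : ∀ x, x = ∑ i, (β x (f i) / a i) • f i := fun x => by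
    simpa only [hff] using eq_sum_of_orthogonal β f hfo hf0 (by simp) x
  have hpar : ∀ x y, β x y = ∑ i, β x (f i) * β y (f i) / a i := fun x y => by
    simpa only [hff] using apply_eq_sum_of_orthogonal β hβs f hfo hf0 (by simp) x y
  -- This embeds the dual M' = L' ⊕ ℤ of M = L ⊕ ⟨1⟩ into M ⊗ ℚ.
  let ι : L.dual × ℤ → (Fin n → ℚ) × ℚ := fun x => (x.1, x.2)
  have hι : ∀ x y, ι (x + y) = ι x + ι y := fun x y => Prod.ext rfl (by simp [ι])
  have hint : ∀ x i, ∃ k : ℤ, (k : ℚ) = β (ι x) (f i) := by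
    intro x i
    obtain ⟨k, hk⟩ := (L.mem_dual_iff _).mp x.1.2 (e i).1
    refine ⟨k + x.2 * (e i).2, ?_⟩
    rw [hβ, addOne_apply]
    push_cast
    rw [hk]
    rfl
  choose κ hκ using hint
  have hκadd : ∀ x y i, κ (x + y) i = κ x i + κ y i := fun x y i => by
    have : ((κ (x + y) i : ℤ) : ℚ) = κ x i + κ y i := by
      rw [hκ, hκ, hκ, hι, map_add, LinearMap.add_apply]
    exact_mod_cast this
  -- The discriminant group of the sublattice spanned by the e_i is ⨁ ℤ/a_i, with generators
  -- e_i/a_i; θ gives the class of a vector of M' in these coordinates. The map π below is the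
  -- quotient M' → M'/M = L'/L, so θ (ker π) is the isotropic image of M.
  let θ : L.dual × ℤ →+ (∀ i, ZMod (a i).natAbs) :=
    AddMonoidHom.mk' (fun x i => (κ x i : ZMod (a i).natAbs)) fun x y => by
      funext i
      simp [hκadd]
  have hθ : ∀ x i, θ x i = (κ x i : ZMod (a i).natAbs) := fun x i => rfl
  obtain ⟨E, hE⟩ := hL
  let π : L.dual × ℤ →+ H := (E : L.DiscriminantGroup →+ H).comp
    ((Submodule.mkQ ((integral n).submoduleOf L.dual)).toAddMonoidHom.comp (AddMonoidHom.fst _ _))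
  have hπ : ∀ x, π x = E (Submodule.Quotient.mk x.1) := fun x => rfl
  have hπ0 : ∀ x, π x = 0 ↔ (x.1 : Fin n → ℚ) ∈ integral n := by
    intro x
    rw [hπ, LinearEquiv.map_eq_zero_iff, Submodule.Quotient.mk_eq_zero]
    rfl
  -- This identifies the pairing sign(a) xy/|a| with xy/a, the linking pairing of ⟨a⟩.
  have hsign : ∀ i, ((a i).sign : ℚ) / ((a i).natAbs : ℚ) = 1 / a i := fun i => by
    have h1 : ((a i).sign : ℚ) * (a i).natAbs = a i := by
      rw [← Int.cast_natCast, ← Int.cast_mul, Int.sign_mul_natAbs]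
    have h2 : ((a i).natAbs : ℚ) * (a i).natAbs = a i * a i := by
      rw [← Int.cast_natCast, ← Int.cast_mul, Int.natAbs_mul_self', Int.cast_mul]
    have h3 : ((a i).natAbs : ℚ) ≠ 0 := NeZero.ne _
    rw [div_eq_div_iff h3 (haq i)]
    apply mul_right_cancel₀ h3
    rw [one_mul, h2, mul_right_comm, h1]
  have hcyc : ∀ (u v : Fin (n + 1) → ℤ), TorsionPairing.directSum (fun i =>
      TorsionPairing.cyclic (a i).natAbs (a i).sign) (fun i => (u i : ZMod (a i).natAbs))
        (fun i => (v i : ZMod (a i).natAbs)) =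
      ((∑ i, (u i : ℚ) * v i / a i : ℚ) : AddCircle (1 : ℚ)) := by
    intro u v
    rw [TorsionPairing.directSum_apply]
    refine Eq.trans ?_ (map_sum (QuotientAddGroup.mk' (AddSubgroup.zmultiples (1 : ℚ))) _ _).symm
    refine Finset.sum_congr rfl fun i _ => (TorsionPairing.cyclic_intCast _ _ _ _).trans ?_
    refine congrArg (QuotientAddGroup.mk' (AddSubgroup.zmultiples (1 : ℚ))) ?_
    rw [mul_assoc, mul_div_right_comm, hsign]
    ring
  refine ⟨_, TorsionPairing.gaussSum_eq_card_mul ?_ _ c ?_ θ π ?_ ?_ ?_ ?_⟩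
  · rw [Fintype.card_pi]
    simp only [ZMod.card]
    exact Finset.prod_induction _ _ (fun _ _ => Odd.mul) odd_one fun i _ =>
      Int.natAbs_odd.mpr (hodd i)
  · intro x y
    rw [TorsionPairing.directSum_apply, TorsionPairing.directSum_apply]
    exact Finset.sum_congr rfl fun i _ => TorsionPairing.cyclic_comm _ _ _ _
  · intro y
    obtain ⟨x, hx⟩ := Submodule.Quotient.mk_surjective _ (E.symm y)
    exact ⟨(x, 0), by rw [hπ, hx, E.apply_symm_apply]⟩
  · intro x hx
    rw [hπ0, mem_integral_iff]
    -- Then x is an integral combination of the e_i, hence lies in M.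
    have hdvd : ∀ i, a i ∣ κ x i := fun i => by
      have := congrFun hx i
      rw [hθ, Pi.zero_apply, ZMod.intCast_zmod_eq_zero_iff_dvd] at this
      exact Int.natAbs_dvd.mp this
    choose m hm using hdvd
    have hx' : ι x = castVec ℚ (∑ i, m i • e i) := by
      have hc : castVec ℚ (∑ i, m i • e i) = ∑ i, (m i : ℚ) • f i := by
        refine Prod.ext ?_ ?_
        · funext j
          simp [castVec, hf, Prod.fst_sum, Finset.sum_apply]
        · simp [castVec, hf, Prod.snd_sum]
      rw [hc, hexp (ι x)]
      refine Finset.sum_congr rfl fun i _ => ?_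
      rw [← hκ, hm, Int.cast_mul, mul_div_cancel_left₀ _ (haq i)]
    exact ⟨_, (congrArg Prod.fst hx').symm⟩
  · intro x y
    have h1 : β (ι x) (ι y) = L.extend ℚ x.1 y.1 + ((x.2 * y.2 : ℤ) : ℚ) := by
      rw [hβ, addOne_apply]
      push_cast
      rfl
    rw [hπ, hπ, hE, linkingPairing_mk]
    refine (hcyc (κ x) (κ y)).trans ?_
    simp only [hκ]
    rw [← hpar, h1, ratCircle_coe_eq_iff]
    exact ⟨_, rfl⟩
  · intro d hd
    choose m hm using fun i => ZMod.intCast_surjective (d i)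
    have hd' : d = fun i => (m i : ZMod (a i).natAbs) := funext fun i => (hm i).symm
    -- The lift of d to the dual of the sublattice. Orthogonality of d to the image of M says that v
    -- has integral products with M, so v lies in M'.
    set v : (Fin n → ℚ) × ℚ := ∑ i, ((m i : ℚ) / a i) • f i with hv
    have hvf : ∀ i, β v (f i) = m i := fun i => by
      rw [hv, LinearMap.map_sum₂, Finset.sum_eq_single i
        (fun j _ hj => by rw [LinearMap.map_smul₂, hfo j i hj, smul_zero]) (by simp),
        LinearMap.map_smul₂, hff, smul_eq_mul, div_mul_cancel₀ _ (haq i)]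
    have hvx : ∀ x, π x = 0 → ∃ k : ℤ, (k : ℚ) = β v (ι x) := by
      intro x hx
      have h := hd x hx
      rw [hd'] at h
      replace h := (hcyc m (κ x)).symm.trans h
      rw [AddCircle.coe_eq_zero_iff] at h
      obtain ⟨k, hk⟩ := h
      refine ⟨k, ?_⟩
      rw [hpar]
      simp only [hvf, ← hκ]
      rw [← hk]
      simp
    have hv2 : ∃ t : ℤ, (t : ℚ) = v.2 := by
      obtain ⟨k, hk⟩ := hvx (0, 1) (by rw [hπ0]; exact Submodule.zero_mem _)
      exact ⟨k, by rw [hk, hβ, addOne_apply]; simp [ι]⟩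
    have hle : ∀ y : Fin n → ℤ, (fun i => (y i : ℚ)) ∈ L.dual := fun y => by
      rw [mem_dual_iff]
      exact fun z => ⟨L.form y z, (L.extend_intCast ℚ y z).symm⟩
    have hv1 : v.1 ∈ L.dual := by
      rw [mem_dual_iff]
      intro y
      obtain ⟨k, hk⟩ := hvx (⟨_, hle y⟩, 0) (by rw [hπ0]; exact ⟨y, rfl⟩)
      exact ⟨k, by rw [hk, hβ, addOne_apply]; simp [ι]⟩
    obtain ⟨t, ht⟩ := hv2
    refine ⟨(⟨v.1, hv1⟩, t), ?_⟩
    rw [hd']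
    funext i
    rw [hθ]
    congr 1
    have : ((κ (⟨v.1, hv1⟩, t) i : ℤ) : ℚ) = m i := by
      rw [hκ, ← hvf]
      congr 2
      exact Prod.ext rfl ht
    exact_mod_cast this

end IntegralLattice

/-! ### Comparison of phases and the congruence for the sum of the norms. -/

namespace TorsionPairing

theorem gaussSum_directSum_of_isTypeA {r : ℕ} {p k : Fin r → ℕ}
    (hp : ∀ i, (p i).Prime ∧ Odd (p i)) [∀ i, NeZero (p i ^ k i)]
    (A : ∀ i, TorsionPairing (ZMod (p i ^ k i))) (hA : ∀ i, IsTypeA (p i) (k i) (A i)) :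
    (directSum A).gaussSum = gaussRoot (∏ i, p i ^ k i) *
      eighthRoot ^ (∑ i with Odd (k i), (p i - 1 : ℤ)) := by
  rw [gaussSum_directSum, gaussRoot_prod _ _ fun i _ => NeZero.ne _, Finset.sum_filter,
    eighthRoot_zpow_sum, ← Finset.prod_mul_distrib]
  exact Finset.prod_congr rfl fun i _ => gaussSum_of_isTypeA (hp i).1 (hp i).2 (hA i)

theorem gaussSum_directSum_of_isTypeB {r : ℕ} {p k : Fin r → ℕ}
    (hp : ∀ i, (p i).Prime ∧ Odd (p i)) [∀ i, NeZero (p i ^ k i)]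
    (B : ∀ i, TorsionPairing (ZMod (p i ^ k i))) (hB : ∀ i, IsTypeB (p i) (k i) (B i)) :
    (directSum B).gaussSum = gaussRoot (∏ i, p i ^ k i) *
      eighthRoot ^ (∑ i with Odd (k i), (p i - 5 : ℤ)) := by
  rw [gaussSum_directSum, gaussRoot_prod _ _ fun i _ => NeZero.ne _, Finset.sum_filter,
    eighthRoot_zpow_sum, ← Finset.prod_mul_distrib]
  exact Finset.prod_congr rfl fun i _ => gaussSum_of_isTypeB (hp i).1 (hp i).2 (hB i)

/-- Comparison of the phases of two Gauss sums that differ by a positive factor. -/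
theorem eight_dvd_of_gaussRoot_mul_eq {M N h : ℕ} (hM : Odd M) (hN : Odd N) {x y : ℤ}
    (H : gaussRoot M * eighthRoot ^ x = h * (gaussRoot N * eighthRoot ^ y)) : 8 ∣ x - y := by
  have hnorm : ∀ {n : ℕ}, Odd n → ‖gaussRoot n‖ ^ 2 = n := fun hn => by
    rw [← norm_pow, gaussRoot_sq hn, Complex.norm_natCast]
  -- Squared absolute values forget the phases. Multiplicativity then gives `gaussRoot M = h *
  -- gaussRoot N` with no sign left undetermined.
  have hMN : M = h ^ 2 * N := by
    have h1 := congrArg (fun z => ‖z‖ ^ 2) H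
    simp only [norm_mul, norm_eighthRoot_zpow, mul_one, Complex.norm_natCast, mul_pow, hnorm hM,
      hnorm hN] at h1
    exact_mod_cast h1
  have hh : Odd h := by
    rw [hMN, Nat.odd_mul] at hM
    exact (Nat.odd_pow_iff two_ne_zero).mp hM.1
  have hr0 : gaussRoot N ≠ 0 := by
    rw [← norm_ne_zero_iff]
    intro h0
    have := hnorm hN
    rw [h0, zero_pow two_ne_zero] at this
    exact hN.pos.ne (by exact_mod_cast this)
  have hh0 : (h : ℂ) ≠ 0 := by exact_mod_cast hh.pos.ne'
  rw [hMN, gaussRoot_mul (pow_ne_zero _ hh.pos.ne') hN.pos.ne', gaussRoot_pow hh.pos.ne',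
    gaussRoot_sq hh, mul_assoc] at H
  have H' := mul_left_cancel₀ hr0 (mul_left_cancel₀ hh0 H)
  rw [← eighthRoot_zpow_eq_one_iff, zpow_sub₀ eighthRoot_ne_zero, H',
    div_self (zpow_ne_zero _ eighthRoot_ne_zero)]

end TorsionPairing

namespace IntegralLattice

open LinearMap.BilinForm

variable {n : ℕ} (L : IntegralLattice n)

/-- The oddity formula for `L ⊕ ⟨1⟩`, in terms of an orthogonal sublattice of odd determinant. -/
theorem eight_dvd_sum_sub (e : Fin (n + 1) → (Fin n → ℤ) × ℤ)
    (hodd : ∀ i, Odd (L.form.addOne (e i) (e i)))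
    (he : ∀ i j, i ≠ j → L.form.addOne (e i) (e j) = 0)
    {r s : ℕ} {p k : Fin r → ℕ} {q l : Fin s → ℕ}
    (hp : ∀ i, (p i).Prime ∧ Odd (p i)) (hq : ∀ j, (q j).Prime ∧ Odd (q j))
    (A : ∀ i, TorsionPairing (ZMod (p i ^ k i)))
    (hA : ∀ i, TorsionPairing.IsTypeA (p i) (k i) (A i))
    (B : ∀ j, TorsionPairing (ZMod (q j ^ l j)))
    (hB : ∀ j, TorsionPairing.IsTypeB (q j) (l j) (B j))
    (hL : TorsionPairing.Isomorphic L.linkingPairing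
      (TorsionPairing.prod (TorsionPairing.directSum A) (TorsionPairing.directSum B))) :
    8 ∣ ∑ i, L.form.addOne (e i) (e i) - (L.signature + 1) -
      (∑ i with Odd (k i), (p i - 1 : ℤ) + ∑ j with Odd (l j), (q j - 5 : ℤ)) := by
  have h0 : ∀ i, L.form.addOne (e i) (e i) ≠ 0 := fun i h => by
    have := hodd i
    rw [h] at this
    exact absurd this (by decide)
  have : ∀ i, NeZero (L.form.addOne (e i) (e i)).natAbs := fun i => ⟨Int.natAbs_ne_zero.mpr (h0 i)⟩
  have : ∀ i, NeZero (p i ^ k i) := fun i => ⟨pow_ne_zero _ (hp i).1.ne_zero⟩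
  have : ∀ j, NeZero (q j ^ l j) := fun j => ⟨pow_ne_zero _ (hq j).1.ne_zero⟩
  obtain ⟨h, hh⟩ := L.exists_gaussSum_directSum_eq e hodd he _ hL
  rw [TorsionPairing.gaussSum_prod, TorsionPairing.gaussSum_directSum_of_isTypeA hp A hA,
    TorsionPairing.gaussSum_directSum_of_isTypeB hq B hB, TorsionPairing.gaussSum_directSum,
    Finset.prod_congr rfl fun i _ => TorsionPairing.gaussSum_cyclic_natAbs _ (hodd i),
    Finset.prod_mul_distrib, ← eighthRoot_zpow_sum,
    ← TorsionPairing.gaussRoot_prod _ _ fun i _ => NeZero.ne _, mul_mul_mul_comm,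
    ← zpow_add₀ eighthRoot_ne_zero, ← TorsionPairing.gaussRoot_mul
      (Finset.prod_ne_zero_iff.mpr fun i _ => NeZero.ne _)
      (Finset.prod_ne_zero_iff.mpr fun i _ => NeZero.ne _), Finset.sum_sub_distrib,
    ← L.signature_add_one e h0 he] at hh
  have hprod : ∀ {m : ℕ} (f : Fin m → ℕ), (∀ i, Odd (f i)) → Odd (∏ i, f i) := fun f hf =>
    Finset.prod_induction _ _ (fun _ _ => Odd.mul) odd_one fun i _ => hf i
  exact TorsionPairing.eight_dvd_of_gaussRoot_mul_eq
    (hprod _ fun i => Int.natAbs_odd.mpr (hodd i))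
    ((hprod _ fun i => (hp i).2.pow).mul (hprod _ fun j => (hq j).2.pow)) hh

/-! ### Norms of dual vectors and of characteristic covectors. -/

/-- The norm of a vector of the dual lattice lies in `δ⁻¹ℤ`. -/
theorem exists_det_mul_norm_eq {x : Fin n → ℚ} (hx : x ∈ L.dual) :
    ∃ m : ℤ, (m : ℚ) = L.det * L.extend ℚ x x := by
  have hz : ∀ j, ∃ k : ℤ, (k : ℚ) = (Matrix.vecMul x (L.gram.map (Int.cast : ℤ → ℚ))) j := by
    intro j
    obtain ⟨k, hk⟩ := (L.mem_dual_iff x).mp hx (Pi.single j 1)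
    refine ⟨k, ?_⟩
    rw [hk, extend, Matrix.toBilin'_apply', Matrix.dotProduct_mulVec]
    have : (fun i => (((Pi.single j 1 : Fin n → ℤ) i : ℤ) : ℚ)) = Pi.single j 1 := by
      funext i
      rcases eq_or_ne i j with rfl | h
      · simp
      · simp [h]
    rw [this, dotProduct_single_one]
  choose z hz using hz
  -- Cramer's rule: the products z of x with the standard basis are integers and δx = z · adj(Gram),
  -- so δx lies in L and pairs integrally with x.
  have hadj : (L.det : ℚ) • x = fun i => ((Matrix.vecMul z L.gram.adjugate i : ℤ) : ℚ) := by
    have h1 : (fun i => ((Matrix.vecMul z L.gram.adjugate i : ℤ) : ℚ)) =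
        Matrix.vecMul (Matrix.vecMul x (L.gram.map (Int.cast : ℤ → ℚ)))
          (L.gram.map (Int.cast : ℤ → ℚ)).adjugate := by
      have h2 : (L.gram.map (Int.cast : ℤ → ℚ)).adjugate =
          L.gram.adjugate.map (Int.cast : ℤ → ℚ) :=
        ((Int.castRingHom ℚ).map_adjugate L.gram).symm
      rw [h2, ← funext hz]
      funext i
      simp [Matrix.vecMul, dotProduct]
    have h3 : (L.gram.map (Int.cast : ℤ → ℚ)).det = L.det :=
      ((Int.castRingHom ℚ).map_det L.gram).symm
    rw [h1, Matrix.vecMul_vecMul, Matrix.mul_adjugate, h3, Matrix.vecMul_smul, Matrix.vecMul_one]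
  obtain ⟨m, hm⟩ := (L.mem_dual_iff x).mp hx (Matrix.vecMul z L.gram.adjugate)
  exact ⟨m, by rw [hm, ← hadj, map_smul, smul_eq_mul]⟩

/-- Modulo `8ℤ₍₂₎`, the norm of a characteristic covector of `L ⊕ ⟨1⟩` is the sum of the norms in an
orthogonal family with odd norms. -/
theorem IsCharacteristic.exists_norm_eq {ξ : Fin n → ℚ} (hξ : L.IsCharacteristic ξ)
    (e : Fin (n + 1) → (Fin n → ℤ) × ℤ)
    (hodd : ∀ i, Odd (L.form.addOne (e i) (e i)))
    (he : ∀ i j, i ≠ j → L.form.addOne (e i) (e j) = 0) :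
    ∃ t : ℤ, ((∏ i, L.form.addOne (e i) (e i) : ℤ) : ℚ) *
      (L.extend ℚ ξ ξ + 1 - ((∑ i, L.form.addOne (e i) (e i) : ℤ) : ℚ)) = 8 * t := by
  set a : Fin (n + 1) → ℤ := fun i => L.form.addOne (e i) (e i) with ha
  have haq : ∀ i, (a i : ℚ) ≠ 0 := fun i h => by
    have h' : a i = 0 := by exact_mod_cast h
    have h2 := hodd i
    change Odd (a i) at h2
    rw [h'] at h2
    exact absurd h2 (by decide)
  -- Writing e_i = (y, t), the product is ξ·y + t ≡ y² + t² = a_i modulo 2, since t ≡ t².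
  have hc : ∀ i, ∃ c : ℤ, Odd c ∧ (L.extend ℚ).addOne (ξ, 1) (castVec ℚ (e i)) = c := by
    intro i
    obtain ⟨z, hz⟩ := AddCommGroup.modEq_iff_eq_add_zsmul.mp (hξ.2 _ ⟨(e i).1, rfl⟩)
    change L.extend ℚ (fun j => ((e i).1 j : ℚ)) (fun j => ((e i).1 j : ℚ)) =
      L.extend ℚ ξ (fun j => ((e i).1 j : ℚ)) + z • (2 : ℚ) at hz
    rw [extend_intCast, zsmul_eq_mul] at hz
    refine ⟨L.form (e i).1 (e i).1 - z * 2 + (e i).2, ?_, ?_⟩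
    · have h1 : L.form (e i).1 (e i).1 - z * 2 + (e i).2 =
          a i - (z * 2 + (e i).2 * ((e i).2 - 1)) := by
        simp only [ha, addOne_apply]
        ring
      rw [h1]
      exact (hodd i).sub_even ((even_two.mul_left z).add (Int.even_mul_pred_self _))
    · rw [addOne_apply, castVec]
      push_cast
      rw [hz]
      ring
  choose c hcodd hc using hc
  have hpar : L.extend ℚ ξ ξ + 1 = ∑ i, (c i : ℚ) * c i / a i := by
    have h1 := apply_eq_sum_of_orthogonal (L.extend ℚ).addOne (addOne_comm (L.extend_comm ℚ))
      (fun i => castVec ℚ (e i))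
      (fun i j hij => by rw [addOne_castVec, he i j hij, Int.cast_zero])
      (fun i => by rw [addOne_castVec]; exact haq i) (by simp) (ξ, 1) (ξ, 1)
    simp only [hc, addOne_castVec] at h1
    rw [← h1, addOne_apply]
    ring
  -- Odd squares are 1 modulo 8, so c_i²/a_i - a_i is 8 times a fraction with denominator a_i;
  -- multiplication by ∏ a_j clears all of these.
  have h8 : ∀ i, ∃ t, c i * c i - a i * a i = 8 * t := fun i => by
    have := (Int.eight_dvd_sq_sub_one_of_odd (hcodd i)).sub
      (Int.eight_dvd_sq_sub_one_of_odd (hodd i))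
    rw [sub_sub_sub_cancel_right, sq, sq] at this
    exact this
  choose t ht using h8
  refine ⟨∑ i, t i * ∏ j ∈ Finset.univ.erase i, a j, ?_⟩
  rw [hpar]
  push_cast
  rw [← Finset.sum_sub_distrib, Finset.mul_sum, Finset.mul_sum]
  refine Finset.sum_congr rfl fun i _ => ?_
  rw [← Finset.mul_prod_erase _ _ (Finset.mem_univ i)]
  have h1 : (c i : ℚ) * c i - a i * a i = 8 * t i := by exact_mod_cast ht i
  have h2 := haq i
  calc (a i : ℚ) * (∏ j ∈ Finset.univ.erase i, (a j : ℚ)) * (c i * c i / a i - a i)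
      = (∏ j ∈ Finset.univ.erase i, (a j : ℚ)) * (c i * c i - a i * a i) := by
        field_simp
    _ = _ := by rw [h1]; ring

end IntegralLattice

theorem mainTheorem5 {n : ℕ} (L : IntegralLattice n) (hδ : Odd L.det)
    {r s : ℕ} (p k : Fin r → ℕ) (q l : Fin s → ℕ)
    (hp : ∀ i, (p i).Prime ∧ Odd (p i)) (hk : ∀ i, 1 ≤ k i)
    (hq : ∀ j, (q j).Prime ∧ Odd (q j)) (hl : ∀ j, 1 ≤ l j)
    (A : ∀ i, TorsionPairing (ZMod (p i ^ k i)))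
    (hA : ∀ i, TorsionPairing.IsTypeA (p i) (k i) (A i))
    (B : ∀ j, TorsionPairing (ZMod (q j ^ l j)))
    (hB : ∀ j, TorsionPairing.IsTypeB (q j) (l j) (B j))
    (hL : TorsionPairing.Isomorphic L.linkingPairing
      (TorsionPairing.prod (TorsionPairing.directSum A) (TorsionPairing.directSum B)))
    (ξ : Fin n → ℚ) (hξ : L.IsCharacteristic ξ) :
    L.extend ℚ ξ ξ ≡
      (L.signature : ℚ) - (∑ i with Odd (k i), (1 - (p i : ℚ))) -
        (∑ j with Odd (l j), (5 - (q j : ℚ)))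
      [PMOD (8 / (L.det : ℚ))] := by
  obtain ⟨e, hodd, he⟩ := L.exists_orthogonal_odd hδ
  obtain ⟨u, hu⟩ := L.eight_dvd_sum_sub e hodd he hp hq A hA B hB hL
  obtain ⟨t, ht⟩ := IntegralLattice.IsCharacteristic.exists_norm_eq L hξ e hodd he
  obtain ⟨m, hm⟩ := L.exists_det_mul_norm_eq hξ.1
  set D : ℤ := ∏ i, L.form.addOne (e i) (e i)
  have hD : Odd D := Finset.prod_induction _ _ (fun _ _ => Odd.mul) odd_one fun i _ => hodd i
  set T : ℤ := L.signature - ∑ i with Odd (k i), (1 - p i : ℤ) - ∑ j with Odd (l j), (5 - q j : ℤ)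
    with hT
  have hTq : (L.signature : ℚ) - (∑ i with Odd (k i), (1 - (p i : ℚ))) -
      (∑ j with Odd (l j), (5 - (q j : ℚ))) = T := by
    rw [hT]
    push_cast
    rfl
  have hsum : ∑ i, L.form.addOne (e i) (e i) = T + 1 + 8 * u := by
    have h1 : ∑ i with Odd (k i), (1 - p i : ℤ) = -∑ i with Odd (k i), (p i - 1 : ℤ) := by
      rw [← Finset.sum_neg_distrib]
      exact Finset.sum_congr rfl fun _ _ => by ring
    have h2 : ∑ j with Odd (l j), (5 - q j : ℤ) = -∑ j with Odd (l j), (q j - 5 : ℤ) := by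
      rw [← Finset.sum_neg_distrib]
      exact Finset.sum_congr rfl fun _ _ => by ring
    rw [hT, h1, h2]
    linear_combination hu
  rw [hsum] at ht
  have hδ0 : (L.det : ℚ) ≠ 0 := by
    intro h
    have h' : L.det = 0 := by exact_mod_cast h
    rw [h'] at hδ
    exact absurd hδ (by decide)
  -- Both denominators are cleared here, D from the orthogonal family and δ from ξ². As D is odd it
  -- can be cancelled, leaving 8 ∣ δξ² - δT.
  have hdvd : 8 ∣ D * (m - L.det * T) := by
    refine ⟨L.det * (t + D * u), ?_⟩
    have : ((D * (m - L.det * T) : ℤ) : ℚ) = ((8 * (L.det * (t + D * u)) : ℤ) : ℚ) := by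
      push_cast at ht ⊢
      rw [hm]
      linear_combination (L.det : ℚ) * ht
    exact_mod_cast this
  have hcop : IsCoprime (8 : ℤ) D := by
    have : IsCoprime (2 : ℤ) D := Int.isCoprime_two_left.mpr hD
    exact this.pow_left (m := 3)
  obtain ⟨w, hw⟩ := hcop.dvd_of_dvd_mul_left hdvd
  rw [hTq, AddCommGroup.modEq_iff_eq_add_zsmul]
  refine ⟨-w, ?_⟩
  have hw' : (L.det : ℚ) * L.extend ℚ ξ ξ - L.det * T = 8 * w := by
    rw [← hm]
    exact_mod_cast hw
  rw [zsmul_eq_mul]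
  push_cast
  field_simp
  linear_combination -hw'
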